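/- Let $M$ be a matroid on a finite ground set $E$, of rank $r$. Its base polytope $P(M)\subseteq\mathbb R^E$ is the convex hull of the incidence vectors of its bases. Put $\Delta=\{x\in[0,1]^E:\sum_{e\in E}x_e=r\}$ and $Q=\Delta\cap\operatorname{aff}P(M)$. The matroid $M$ is called a \emph{split matroid} if, for any two distinct facets $F,G$ of $P(M)$ whose affine hulls both meet the relative interior of $Q$, the intersection $\operatorname{aff}F\cap\operatorname{aff}G$ contains no point of the relative interior of $Q$. It is called \emph{paving} if every subset of $E$ with at most $r-1$ elements is independent. If $M$ is a split matroid, then for any two bases $A,B$ of $M$ there are orderings $A=\{a_1,\dots,a_r\}$ and $B=\{b_1,\dots,b_r\}$ such that $\{a_1,\dots,a_i,b_{i+1},\dots,b_r\}$ and $\{b_1,\dots,b_i,a_{i+1},\dots,a_r\}$ are bases of $M$ for every $i=0,\dots,r$. In particular, the same holds if $M$ is a paving matroid. -/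

import Mathlib

namespace Matroid

variable {α : Type*}

/-- The base polytope `P(M)` in `ℝ^E`: the convex hull of the incidence vectors of the bases.
Vectors are functions on the whole type `α`; those in `P(M)` vanish outside the ground set. -/
def basePolytope (M : Matroid α) : Set (α → ℝ) :=
  convexHull ℝ {x | ∃ B, M.IsBase B ∧ x = B.indicator 1}

/-- The hypersimplex `Δ(r, E) = {x ∈ [0,1]^E : ∑ x_e = r}`, where `E` is the ground set and
`r` the rank of `M`: the base polytope of the rank-`r` uniform matroid on `E`. -/
def hypersimplex (M : Matroid α) : Set (α → ℝ) :=
  {x | (∀ e ∈ M.E, 0 ≤ x e ∧ x e ≤ 1) ∧ (∀ e, e ∉ M.E → x e = 0) ∧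
    ∑ᶠ e ∈ M.E, x e = (M.eRank.toNat : ℝ)}

/-- The part of the hypersimplex in the affine hull of `P(M)`.
For a connected matroid this is the whole hypersimplex. -/
def hypersimplexSection (M : Matroid α) : Set (α → ℝ) :=
  M.hypersimplex ∩ affineSpan ℝ M.basePolytope

/-- `F` is a facet of the convex polytope `P`: a nonempty face of codimension one. -/
def IsFacet (P F : Set (α → ℝ)) : Prop :=
  IsExposed ℝ P F ∧ F.Nonempty ∧
    Module.finrank ℝ (vectorSpan ℝ F) + 1 = Module.finrank ℝ (vectorSpan ℝ P)

/-- A split facet of `M`: a facet of `P(M)` whose affine hull (a hyperplane in the affine hull of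
`P(M)`) meets the relative interior of the hypersimplex section, and so cuts it in two.
The remaining facets of `P(M)` lie in the boundary of the hypersimplex section. -/
def IsSplitFacet (M : Matroid α) (F : Set (α → ℝ)) : Prop :=
  IsFacet M.basePolytope F ∧
    ((affineSpan ℝ F : Set (α → ℝ)) ∩ intrinsicInterior ℝ M.hypersimplexSection).Nonempty

/-- A split matroid (Joswig and Schröter): the hyperplanes of the split facets are pairwise
compatible, that is, no two of them meet in the relative interior of the hypersimplex section. -/
def IsSplit (M : Matroid α) : Prop :=
  ∀ F G : Set (α → ℝ), M.IsSplitFacet F → M.IsSplitFacet G → F ≠ G →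
    Disjoint ((affineSpan ℝ F : Set (α → ℝ)) ∩ affineSpan ℝ G)
      (intrinsicInterior ℝ M.hypersimplexSection)

/-- A paving matroid: every set with fewer elements than the rank is independent. -/
def IsPaving (M : Matroid α) : Prop :=
  ∀ X ⊆ M.E, X.encard < M.eRank → M.Indep X

/-- The sequential symmetric exchange property. The orderings are indexed from `0`, so that
`{a_1, …, a_i}` is the image of the indices below `i`. -/
def SequentialSymmetricExchange (M : Matroid α) : Prop :=
  ∀ A B : Set α, M.IsBase A → M.IsBase B →
    ∃ (r : ℕ) (a b : Fin r → α),
      Function.Injective a ∧ Set.range a = A ∧ Function.Injective b ∧ Set.range b = B ∧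
      ∀ i ≤ r,
        M.IsBase (a '' {j | j.val < i} ∪ b '' {j | i ≤ j.val}) ∧
        M.IsBase (b '' {j | j.val < i} ∪ a '' {j | i ≤ j.val})

end Matroid

/-! The bases are described, component by component in the split case, as the `n`-sets that meet
each member `H` of a family in at most `c H` elements, where the family is sparse: `#(H ∩ K) + n ≤ c
H + c K` for distinct members. The theorem then follows from a purely combinatorial statement,
`SparseExchange.exists_exchange_list`.

Sparseness makes two members `T`, `T'` that are tight for an `n`-set `X` satisfy `T ∩ T' ⊆ X ⊆ T ∪
T'` (`tight_pair`). Hence an element outside `X` lies in at most one tight member, and an element of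
`X` avoids at most one. So exchanging one pair at a time can get stuck only in a rigid way: the
elements still to be exchanged fall into a 2 × 2 table with equal margins on both sides but
different cells, while every allowed exchange stays within a cell. There is no such obstruction at
the start (`IsState.not_isObstruction`), and when there is none, some exchange creates none
(`IsState.exists_valid`); induction finishes.

For a paving matroid the family consists of the hyperplanes, with capacity the rank. For a split
matroid, fix a connected component `C` and take the sets `F ⊂ C` with `M ↾ F` and `(M ↾ C) / F`
connected and `r(F) < #F`, `r(F) < r(C)`. A dependent subset of `C` of size `r(C)` violates the
inequality of some such `F` (`IsConn.exists_isSplitFlacet`), and each `F` gives a facet of the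
polytope (`isFacet_face`). If sparseness failed for two of them, a point that is constant on the
four regions cut out in `C` would lie on both hyperplanes and in the relative interior of `Q`,
against the split condition (`IsSplit.card_inter_add_le`). The orderings of the components are
concatenated by `HasExchangeList.union`. -/

/-! ### Exchange sequences in sparse capacitated set systems -/

namespace SparseExchange

open Finset

variable {α : Type*} [DecidableEq α] {𝓗 : Set (Finset α)} {c : Finset α → ℕ} {n : ℕ}
  {X W A B T T' T₁ T₂ S₁ S₂ : Finset α} {a b : α}

/-- `X` meets every member of the family in at most its capacity. -/
def Feasible (𝓗 : Set (Finset α)) (c : Finset α → ℕ) (X : Finset α) : Prop :=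
  ∀ H ∈ 𝓗, #(X ∩ H) ≤ c H

/-- Distinct members of the family intersect in few elements, relative to the size `n`. -/
def Sparse (𝓗 : Set (Finset α)) (c : Finset α → ℕ) (n : ℕ) : Prop :=
  ∀ H ∈ 𝓗, ∀ K ∈ 𝓗, H ≠ K → #(H ∩ K) + n ≤ c H + c K

/-- A pair of feasible sets `X`, `W`, together with a set `A ⊆ W \ X` that is to enter `X`
and a set `B ⊆ X \ W` that is to enter `W`, such that the resulting sets are feasible. -/
structure IsState (𝓗 : Set (Finset α)) (c : Finset α → ℕ) (n : ℕ)
    (X W A B : Finset α) : Prop where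
  card_left : #X = n
  card_right : #W = n
  subset_right : A ⊆ W
  disj_left : Disjoint A X
  subset_left : B ⊆ X
  disj_right : Disjoint B W
  card_eq : #A = #B
  feasible_left : Feasible 𝓗 c X
  feasible_right : Feasible 𝓗 c W
  feasible_left_end : ∀ H ∈ 𝓗, #(X ∩ H) + #(A ∩ H) ≤ c H + #(B ∩ H)
  feasible_right_end : ∀ H ∈ 𝓗, #(W ∩ H) + #(B ∩ H) ≤ c H + #(A ∩ H)

/-- An obstruction to completing the exchange: two members `T₁`, `T₂` tight for `X`, and two
members `S₁`, `S₂` tight for `W`, allow only exchanges that keep the type of the elements, but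
the types of the elements of `A` and of `B` do not match. -/
structure IsObstruction (𝓗 : Set (Finset α)) (c : Finset α → ℕ)
    (X W A B T₁ T₂ S₁ S₂ : Finset α) : Prop where
  mem₁ : T₁ ∈ 𝓗
  mem₂ : T₂ ∈ 𝓗
  mem₃ : S₁ ∈ 𝓗
  mem₄ : S₂ ∈ 𝓗
  tight₁ : #(X ∩ T₁) = c T₁
  tight₂ : #(X ∩ T₂) = c T₂
  tight₃ : #(W ∩ S₁) = c S₁
  tight₄ : #(W ∩ S₂) = c S₂
  typeA_T : ∀ e ∈ A, (e ∈ T₁ ↔ e ∉ T₂)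
  typeB_T : ∀ e ∈ B, (e ∈ T₁ ↔ e ∉ T₂)
  typeA_S : ∀ e ∈ A, (e ∈ S₁ ↔ e ∉ S₂)
  typeB_S : ∀ e ∈ B, (e ∈ S₁ ↔ e ∉ S₂)
  lt : #(A ∩ T₁ ∩ S₁) < #(B ∩ T₁ ∩ S₁)

/-- Exchanging `a ∈ A` with `b ∈ B` keeps both sets feasible. -/
structure IsValid (𝓗 : Set (Finset α)) (c : Finset α → ℕ)
    (X W A B : Finset α) (a b : α) : Prop where
  memA : a ∈ A
  memB : b ∈ B
  left : ∀ H ∈ 𝓗, #(X ∩ H) = c H → a ∈ H → b ∈ H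
  right : ∀ H ∈ 𝓗, #(W ∩ H) = c H → b ∈ H → a ∈ H

lemma card_inter_add_card_inter {Z S₁ S₂ : Finset α} (h : ∀ e ∈ Z, (e ∈ S₁ ↔ e ∉ S₂)) :
    #(Z ∩ S₁) + #(Z ∩ S₂) = #Z := by
  rw [← card_union_of_disjoint]
  · congr 1
    ext e
    simp only [mem_union, mem_inter]
    have := h e
    tauto
  · rw [disjoint_left]
    intro e
    simp only [mem_inter]
    have := h e
    tauto

lemma card_exchange_inter (ha : a ∉ X) (hb : b ∈ X) (H : Finset α) :
    #(insert a (X.erase b) ∩ H) + (if b ∈ H then 1 else 0)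
      = #(X ∩ H) + (if a ∈ H then 1 else 0) := by
  have h1 : #((X.erase b) ∩ H) + (if b ∈ H then 1 else 0) = #(X ∩ H) := by
    split_ifs with h
    · rw [erase_inter, card_erase_add_one (by simp [hb, h])]
    · rw [erase_inter, erase_eq_of_notMem (by simp [h]), add_zero]
  have h2 : #(insert a (X.erase b) ∩ H) = #((X.erase b) ∩ H) + (if a ∈ H then 1 else 0) := by
    split_ifs with h
    · rw [insert_inter_of_mem h, card_insert_of_notMem (by simp [ha])]
    · rw [insert_inter_of_notMem h, add_zero]
  omega

lemma card_erase_inter (ha : a ∈ A) (H : Finset α) :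
    #(A.erase a ∩ H) + (if a ∈ H then 1 else 0) = #(A ∩ H) := by
  split_ifs with h
  · rw [erase_inter, card_erase_add_one (by simp [ha, h])]
  · rw [erase_inter, erase_eq_of_notMem (by simp [h]), add_zero]

/-- Two distinct members that are tight for the same set cover it, and meet inside it. -/
lemma tight_pair (hs : Sparse 𝓗 c n) (hX : #X = n) (hT : T ∈ 𝓗) (hT' : T' ∈ 𝓗) (hne : T ≠ T')
    (h : #(X ∩ T) = c T) (h' : #(X ∩ T') = c T') : T ∩ T' ⊆ X ∧ X ⊆ T ∪ T' := by
  have h1 := card_union_add_card_inter (X ∩ T) (X ∩ T')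
  have h2 := hs T hT T' hT' hne
  have h3 : #(X ∩ T ∪ X ∩ T') ≤ #X := card_le_card (by grind)
  have h4 : #(X ∩ T ∩ (X ∩ T')) ≤ #(T ∩ T') := card_le_card (by grind)
  have h5 : X ∩ T ∪ X ∩ T' = X := eq_of_subset_of_card_le (by grind) (by omega)
  have h6 : X ∩ T ∩ (X ∩ T') = T ∩ T' := eq_of_subset_of_card_le (by grind) (by omega)
  constructor <;> grind

lemma IsState.symm (h : IsState 𝓗 c n X W A B) : IsState 𝓗 c n W X B A :=
  ⟨h.card_right, h.card_left, h.subset_left, h.disj_right, h.subset_right, h.disj_left,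
    h.card_eq.symm, h.feasible_right, h.feasible_left, h.feasible_right_end, h.feasible_left_end⟩

lemma IsValid.symm (h : IsValid 𝓗 c X W A B a b) : IsValid 𝓗 c W X B A b a :=
  ⟨h.memB, h.memA, h.right, h.left⟩

/-- The sets that `X` and `W` are to become do not change, so the end conditions are inherited.
Validity says that only members with spare capacity gain an element. -/
lemma IsValid.isState (h : IsState 𝓗 c n X W A B) (hv : IsValid 𝓗 c X W A B a b) :
    IsState 𝓗 c n (insert a (X.erase b)) (insert b (W.erase a)) (A.erase a) (B.erase b) := by
  have haX : a ∉ X := disjoint_left.1 h.disj_left hv.memA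
  have hbW : b ∉ W := disjoint_left.1 h.disj_right hv.memB
  have haW : a ∈ W := h.subset_right hv.memA
  have hbX : b ∈ X := h.subset_left hv.memB
  have hX := card_exchange_inter haX hbX
  have hW := card_exchange_inter hbW haW
  have hA := card_erase_inter hv.memA
  have hB := card_erase_inter hv.memB
  have hsA := h.subset_right
  have hsB := h.subset_left
  have hdA := h.disj_left
  have hdB := h.disj_right
  rw [disjoint_left] at hdA hdB
  refine ⟨?_, ?_, by grind, ?_, by grind, ?_, ?_, ?_, ?_, ?_, ?_⟩
  · rw [card_insert_of_notMem (by simp [haX]), card_erase_add_one hbX, h.card_left]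
  · rw [card_insert_of_notMem (by simp [hbW]), card_erase_add_one haW, h.card_right]
  · rw [disjoint_left]; grind
  · rw [disjoint_left]; grind
  · rw [card_erase_of_mem hv.memA, card_erase_of_mem hv.memB, h.card_eq]
  · intro H hH
    have h1 := h.feasible_left H hH
    have h2 := hv.left H hH
    have h3 := hX H
    split_ifs at h3 <;> grind
  · intro H hH
    have h1 := h.feasible_right H hH
    have h2 := hv.right H hH
    have h3 := hW H
    split_ifs at h3 <;> grind
  · intro H hH
    have h1 := h.feasible_left_end H hH
    have h2 := hA H
    have h3 := hX H
    have h4 := hB H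
    omega
  · intro H hH
    have h1 := h.feasible_right_end H hH
    have h2 := hA H
    have h3 := hW H
    have h4 := hB H
    omega

/-! ### Counting in the cells of an obstruction -/

section Obstruction

variable (hst : IsState 𝓗 c n X W A B) (ho : IsObstruction 𝓗 c X W A B T₁ T₂ S₁ S₂)
include hst ho

/-- Tightness turns feasibility at the end into `≤` for both members, and the two sides have the
same total `#A = #B`. -/
lemma IsObstruction.card_T : #(A ∩ T₁) = #(B ∩ T₁) ∧ #(A ∩ T₂) = #(B ∩ T₂) := by
  have h1 := hst.feasible_left_end T₁ ho.mem₁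
  have h2 := hst.feasible_left_end T₂ ho.mem₂
  have h3 := card_inter_add_card_inter ho.typeA_T
  have h4 := card_inter_add_card_inter ho.typeB_T
  have h5 := ho.tight₁
  have h6 := ho.tight₂
  have h7 := hst.card_eq
  omega

lemma IsObstruction.card_S : #(A ∩ S₁) = #(B ∩ S₁) ∧ #(A ∩ S₂) = #(B ∩ S₂) := by
  have h1 := hst.feasible_right_end S₁ ho.mem₃
  have h2 := hst.feasible_right_end S₂ ho.mem₄
  have h3 := card_inter_add_card_inter ho.typeA_S
  have h4 := card_inter_add_card_inter ho.typeB_S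
  have h5 := ho.tight₃
  have h6 := ho.tight₄
  have h7 := hst.card_eq
  omega

/-- `A` and `B` have 2 × 2 tables with equal margins, so a strict inequality in one cell alternates
around the table. -/
lemma IsObstruction.cells :
    #(B ∩ T₁ ∩ S₂) < #(A ∩ T₁ ∩ S₂) ∧ #(B ∩ T₂ ∩ S₁) < #(A ∩ T₂ ∩ S₁) ∧
      #(A ∩ T₂ ∩ S₂) < #(B ∩ T₂ ∩ S₂) := by
  have hT := ho.card_T hst
  have hS := ho.card_S hst
  have hlt := ho.lt
  have key : ∀ (Z U : Finset α), (∀ e ∈ Z, (e ∈ S₁ ↔ e ∉ S₂)) →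
      #(Z ∩ U ∩ S₁) + #(Z ∩ U ∩ S₂) = #(Z ∩ U) :=
    fun Z U h ↦ card_inter_add_card_inter fun e he ↦ h e (mem_of_mem_inter_left he)
  have key' : ∀ (Z U : Finset α), (∀ e ∈ Z, (e ∈ T₁ ↔ e ∉ T₂)) →
      #(Z ∩ T₁ ∩ U) + #(Z ∩ T₂ ∩ U) = #(Z ∩ U) := fun Z U h ↦ by
    rw [inter_right_comm Z T₁, inter_right_comm Z T₂]
    exact card_inter_add_card_inter fun e he ↦ h e (mem_of_mem_inter_left he)
  have a1 := key A T₁ ho.typeA_S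
  have a2 := key A T₂ ho.typeA_S
  have b1 := key B T₁ ho.typeB_S
  have b2 := key B T₂ ho.typeB_S
  have c1 := key' A S₁ ho.typeA_T
  have c2 := key' B S₁ ho.typeB_T
  omega

/-- Swapping sides calls for a cell in which `A` has more elements than `B`; this is the cell of
`T₂` and `S₁`, hence the reversed order of `T₂`, `T₁`. -/
lemma IsObstruction.symm : IsObstruction 𝓗 c W X B A S₁ S₂ T₂ T₁ where
  mem₁ := ho.mem₃
  mem₂ := ho.mem₄
  mem₃ := ho.mem₂
  mem₄ := ho.mem₁
  tight₁ := ho.tight₃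
  tight₂ := ho.tight₄
  tight₃ := ho.tight₂
  tight₄ := ho.tight₁
  typeA_T := ho.typeB_S
  typeB_T := ho.typeA_S
  typeA_S := fun e he ↦ by have := ho.typeB_T e he; tauto
  typeB_S := fun e he ↦ by have := ho.typeA_T e he; tauto
  lt := by
    rw [inter_right_comm, inter_right_comm A]
    exact (ho.cells hst).2.1

lemma IsObstruction.exists_mem :
    (∃ e ∈ B, e ∈ T₁ ∧ e ∈ S₁) ∧ (∃ e ∈ B, e ∈ T₂ ∧ e ∈ S₂) ∧
    (∃ e ∈ A, e ∈ T₁ ∧ e ∈ S₂) ∧ (∃ e ∈ A, e ∈ T₂ ∧ e ∈ S₁) := by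
  have key : ∀ {U V Z S : Finset α}, #(U ∩ V ∩ Z) < #(S ∩ V ∩ Z) → ∃ e ∈ S, e ∈ V ∧ e ∈ Z := by
    intro U V Z S h
    obtain ⟨e, he⟩ := card_pos.1 (lt_of_le_of_lt (Nat.zero_le _) h)
    simp only [mem_inter] at he
    exact ⟨e, he.1.1, he.1.2, he.2⟩
  obtain ⟨h1, h2, h3⟩ := ho.cells hst
  exact ⟨key ho.lt, key h3, key h1, key h2⟩

end Obstruction

/-! ### Blocked exchanges -/

lemma IsState.eq_of_mem_of_notMem (hs : Sparse 𝓗 c n) (h : IsState 𝓗 c n X W A B)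
    (ha : a ∉ X) {H K : Finset α} (hH : H ∈ 𝓗) (hK : K ∈ 𝓗)
    (tH : #(X ∩ H) = c H) (tK : #(X ∩ K) = c K) (haH : a ∈ H) (haK : a ∈ K) : H = K := by
  by_contra hne
  exact ha ((tight_pair hs h.card_left hH hK hne tH tK).1 (mem_inter.2 ⟨haH, haK⟩))

lemma IsState.eq_of_notMem_of_mem (hs : Sparse 𝓗 c n) (h : IsState 𝓗 c n X W A B)
    (ha : a ∈ X) {H K : Finset α} (hH : H ∈ 𝓗) (hK : K ∈ 𝓗)
    (tH : #(X ∩ H) = c H) (tK : #(X ∩ K) = c K) (haH : a ∉ H) (haK : a ∉ K) : H = K := by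
  by_contra hne
  have := (tight_pair hs h.card_left hH hK hne tH tK).2 ha
  grind

/-- If no exchange is valid for `a`, then `a` lies in a tight member `T` for `X` and outside a
tight member `S` for `W`, and `B ∩ T ⊆ S`. -/
lemma IsState.exists_blocking (hs : Sparse 𝓗 c n) (h : IsState 𝓗 c n X W A B)
    (ha : a ∈ A) (hn : ∀ b, ¬ IsValid 𝓗 c X W A B a b) :
    ∃ T ∈ 𝓗, #(X ∩ T) = c T ∧ a ∈ T ∧ ∃ S ∈ 𝓗, #(W ∩ S) = c S ∧ a ∉ S ∧
      (∃ b ∈ B, b ∈ T) ∧ (∃ b ∈ B, b ∉ S) ∧ ∀ b ∈ B, b ∈ T → b ∈ S := by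
  have haX : a ∉ X := disjoint_left.1 h.disj_left ha
  have haW : a ∈ W := h.subset_right ha
  have hbad : ∀ b ∈ B, (∃ H ∈ 𝓗, #(X ∩ H) = c H ∧ a ∈ H ∧ b ∉ H) ∨
      (∃ H ∈ 𝓗, #(W ∩ H) = c H ∧ b ∈ H ∧ a ∉ H) := by
    intro b hb
    by_contra hcon
    push Not at hcon
    exact hn b ⟨ha, hb, fun H hH t haH ↦ hcon.1 H hH t haH, fun H hH t hbH ↦ hcon.2 H hH t hbH⟩
  -- If a tight `S` missing `a` contained all of `B`, then `W` would end with more than `c S`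
  -- elements in `S`.
  have hmiss : ∀ S ∈ 𝓗, #(W ∩ S) = c S → a ∉ S → ∃ b ∈ B, b ∉ S := by
    intro S hS tS haS
    by_contra hcon
    push Not at hcon
    have h1 := h.feasible_right_end S hS
    have h2 : B ∩ S = B := inter_eq_left.2 hcon
    have h3 : #(A ∩ S) < #A := card_lt_card (by
      refine ⟨inter_subset_left, fun hsub ↦ haS (mem_inter.1 (hsub ha)).2⟩)
    have h4 := h.card_eq
    rw [h2] at h1
    omega
  by_cases hT : ∃ T ∈ 𝓗, #(X ∩ T) = c T ∧ a ∈ T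
  · obtain ⟨T, hT, tT, haT⟩ := hT
    have hB : ∃ b ∈ B, b ∈ T := by
      have h1 := h.feasible_left_end T hT
      have h2 : 0 < #(A ∩ T) := card_pos.2 ⟨a, mem_inter.2 ⟨ha, haT⟩⟩
      obtain ⟨b, hb⟩ := card_pos.1 (show 0 < #(B ∩ T) by omega)
      exact ⟨b, (mem_inter.1 hb).1, (mem_inter.1 hb).2⟩
    have hsec : ∀ b ∈ B, b ∈ T → ∃ H ∈ 𝓗, #(W ∩ H) = c H ∧ b ∈ H ∧ a ∉ H := by
      intro b hb hbT
      rcases hbad b hb with ⟨H, hH, tH, haH, hbH⟩ | h'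
      · exact absurd (h.eq_of_mem_of_notMem hs haX hT hH tT tH haT haH ▸ hbT) hbH
      · exact h'
    obtain ⟨b, hb, hbT⟩ := hB
    obtain ⟨S, hS, tS, hbS, haS⟩ := hsec b hb hbT
    refine ⟨T, hT, tT, haT, S, hS, tS, haS, ⟨b, hb, hbT⟩, hmiss S hS tS haS, fun b' hb' hbT' ↦ ?_⟩
    obtain ⟨S', hS', tS', hbS', haS'⟩ := hsec b' hb' hbT'
    rwa [h.symm.eq_of_notMem_of_mem hs haW hS hS' tS tS' haS haS']
  -- With no tight member through `a`, all of `B` is blocked by one and the same `S`, contrary to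
  -- `hmiss`.
  · exfalso
    push Not at hT
    have hsec : ∀ b ∈ B, ∃ H ∈ 𝓗, #(W ∩ H) = c H ∧ b ∈ H ∧ a ∉ H := by
      intro b hb
      rcases hbad b hb with ⟨H, hH, tH, haH, hbH⟩ | h'
      · exact absurd haH (hT H hH tH)
      · exact h'
    obtain ⟨b, hb⟩ : B.Nonempty := by
      rw [← card_pos, ← h.card_eq, card_pos]
      exact ⟨a, ha⟩
    obtain ⟨S, hS, tS, hbS, haS⟩ := hsec b hb
    obtain ⟨b', hb', hbS'⟩ := hmiss S hS tS haS
    obtain ⟨S', hS', tS', hbS'', haS'⟩ := hsec b' hb'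
    rw [h.symm.eq_of_notMem_of_mem hs haW hS hS' tS tS' haS haS'] at hbS'
    exact hbS' hbS''

/-- Blocking `a₁` gives `T₁`, `S₁` and some `b₁ ∉ S₁`; blocking `b₁` gives `S₂` and some `a₂ ∉ T₁`;
blocking `a₂` gives `T₂`. By uniqueness of tight members these four sort everything: `B` lies in the
cells `(T₁, S₁)` and `(T₂, S₂)`, and `A` in the other two. -/
lemma IsState.exists_obstruction (hs : Sparse 𝓗 c n) (h : IsState 𝓗 c n X W A B)
    (hA : A.Nonempty) (hn : ∀ a b, ¬ IsValid 𝓗 c X W A B a b) :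
    ∃ T₁ T₂ S₁ S₂, IsObstruction 𝓗 c X W A B T₁ T₂ S₁ S₂ := by
  have haX : ∀ a ∈ A, a ∉ X := fun a ha ↦ disjoint_left.1 h.disj_left ha
  have haW : ∀ a ∈ A, a ∈ W := fun a ha ↦ h.subset_right ha
  have hbX : ∀ b ∈ B, b ∈ X := fun b hb ↦ h.subset_left hb
  have hbW : ∀ b ∈ B, b ∉ W := fun b hb ↦ disjoint_left.1 h.disj_right hb
  have uT : ∀ a ∈ A, ∀ H ∈ 𝓗, ∀ K ∈ 𝓗, #(X ∩ H) = c H → #(X ∩ K) = c K → a ∈ H → a ∈ K →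
      H = K := fun a ha H hH K hK ↦ h.eq_of_mem_of_notMem hs (haX a ha) hH hK
  have uT' : ∀ b ∈ B, ∀ H ∈ 𝓗, ∀ K ∈ 𝓗, #(X ∩ H) = c H → #(X ∩ K) = c K → b ∉ H → b ∉ K →
      H = K := fun a ha H hH K hK ↦ h.eq_of_notMem_of_mem hs (hbX a ha) hH hK
  have uS : ∀ b ∈ B, ∀ H ∈ 𝓗, ∀ K ∈ 𝓗, #(W ∩ H) = c H → #(W ∩ K) = c K → b ∈ H → b ∈ K →
      H = K := fun a ha H hH K hK ↦ h.symm.eq_of_mem_of_notMem hs (hbW a ha) hH hK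
  have uS' : ∀ a ∈ A, ∀ H ∈ 𝓗, ∀ K ∈ 𝓗, #(W ∩ H) = c H → #(W ∩ K) = c K → a ∉ H → a ∉ K →
      H = K := fun a ha H hH K hK ↦ h.symm.eq_of_notMem_of_mem hs (haW a ha) hH hK
  have bl := fun a (ha : a ∈ A) ↦ h.exists_blocking hs ha (hn a)
  have bl' := fun b (hb : b ∈ B) ↦ h.symm.exists_blocking hs hb (fun a hv ↦ hn a b hv.symm)
  obtain ⟨a₁, ha₁⟩ := hA
  obtain ⟨T₁, hT₁, tT₁, haT₁, S₁, hS₁, tS₁, haS₁, ⟨b₂, hb₂, hbT₂⟩, ⟨b₁, hb₁, hbS₁⟩, hsub₁⟩ :=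
    bl a₁ ha₁
  have hbT₁ : b₁ ∉ T₁ := fun h' ↦ hbS₁ (hsub₁ b₁ hb₁ h')
  obtain ⟨S₂, hS₂, tS₂, hbS₂, T₁', hT₁', tT₁', hbT₁', -, ⟨a₂, ha₂, haT₂⟩, -⟩ := bl' b₁ hb₁
  obtain rfl : T₁ = T₁' := uT' b₁ hb₁ _ hT₁ _ hT₁' tT₁ tT₁' hbT₁ hbT₁'
  obtain ⟨T₂, hT₂, tT₂, ha₂T₂, S₂', hS₂', tS₂', haS₂', -, -, hsub₂⟩ := bl a₂ ha₂
  have hT12 : T₁ ≠ T₂ := by rintro rfl; exact haT₂ ha₂T₂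
  have hb₁T₂ : b₁ ∈ T₂ := by
    by_contra hcon
    exact hT12 (uT' b₁ hb₁ _ hT₁ _ hT₂ tT₁ tT₂ hbT₁ hcon)
  obtain rfl : S₂ = S₂' := uS b₁ hb₁ _ hS₂ _ hS₂' tS₂ tS₂' hbS₂ (hsub₂ b₁ hb₁ hb₁T₂)
  have hS12 : S₁ ≠ S₂ := by rintro rfl; exact hbS₁ hbS₂
  have hb₂S₁ := hsub₁ b₂ hb₂ hbT₂
  have hb₂S₂ : b₂ ∉ S₂ := fun h' ↦ hS12 (uS b₂ hb₂ _ hS₁ _ hS₂ tS₁ tS₂ hb₂S₁ h')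
  have hb₂T₂ : b₂ ∉ T₂ := fun h' ↦ hb₂S₂ (hsub₂ b₂ hb₂ h')
  have hA₁ : ∀ e ∈ A, e ∈ T₁ → e ∉ S₁ := by
    intro e he heT
    obtain ⟨T, hT, tT, heT', S, hS, tS, heS, -, -, hsub⟩ := bl e he
    obtain rfl : T = T₁ := uT e he _ hT _ hT₁ tT tT₁ heT' heT
    rwa [uS b₂ hb₂ _ hS₁ _ hS tS₁ tS hb₂S₁ (hsub b₂ hb₂ hbT₂)]
  have hA₂ : ∀ e ∈ A, e ∈ T₂ → e ∉ S₂ := by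
    intro e he heT
    obtain ⟨T, hT, tT, heT', S, hS, tS, heS, -, -, hsub⟩ := bl e he
    obtain rfl : T = T₂ := uT e he _ hT _ hT₂ tT tT₂ heT' heT
    rwa [uS b₁ hb₁ _ hS₂ _ hS tS₂ tS hbS₂ (hsub b₁ hb₁ hb₁T₂)]
  -- A third tight member through `e` would contain both `b₁` and `b₂`, and the set blocking `e` for
  -- `W` would then equal both `S₁` and `S₂`.
  have hA₃ : ∀ e ∈ A, e ∉ T₁ → e ∈ T₂ := by
    intro e he heT₁
    obtain ⟨T, hT, tT, heT, S, hS, tS, heS, -, -, hsub⟩ := bl e he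
    by_contra heT₂
    have h1 : b₁ ∈ T := by
      by_contra h'
      rw [uT' b₁ hb₁ _ hT₁ _ hT tT₁ tT hbT₁ h'] at heT₁
      exact heT₁ heT
    have h2 : b₂ ∈ T := by
      by_contra h'
      rw [uT' b₂ hb₂ _ hT₂ _ hT tT₂ tT hb₂T₂ h'] at heT₂
      exact heT₂ heT
    exact hS12 ((uS b₂ hb₂ _ hS₁ _ hS tS₁ tS hb₂S₁ (hsub b₂ hb₂ h2)).trans
      (uS b₁ hb₁ _ hS₂ _ hS tS₂ tS hbS₂ (hsub b₁ hb₁ h1)).symm)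
  have hBT : ∀ e ∈ B, (e ∈ T₁ ↔ e ∉ T₂) := by
    intro e he
    constructor
    · intro h1 h2
      exact hS12 (uS e he _ hS₁ _ hS₂ tS₁ tS₂ (hsub₁ e he h1) (hsub₂ e he h2))
    · intro h2
      by_contra h1
      exact hT12 (uT' e he _ hT₁ _ hT₂ tT₁ tT₂ h1 h2)
  refine ⟨T₁, T₂, S₁, S₂, hT₁, hT₂, hS₁, hS₂, tT₁, tT₂, tS₁, tS₂, ?_, hBT, ?_, ?_, ?_⟩
  · intro e he
    exact ⟨fun h1 h2 ↦ hT12 (uT e he _ hT₁ _ hT₂ tT₁ tT₂ h1 h2),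
      fun h2 ↦ by_contra fun h1 ↦ h2 (hA₃ e he h1)⟩
  · intro e he
    constructor
    · intro h1
      exact hA₂ e he (hA₃ e he fun h' ↦ hA₁ e he h' h1)
    · intro h2
      by_contra h1
      exact hS12 (uS' e he _ hS₁ _ hS₂ tS₁ tS₂ h1 h2)
  · intro e he
    constructor
    · intro h1 h2
      exact hS12 (uS e he _ hS₁ _ hS₂ tS₁ tS₂ h1 h2)
    · intro h2
      by_cases h1 : e ∈ T₁
      · exact hsub₁ e he h1
      · exact absurd (hsub₂ e he (by_contra fun h' ↦ h1 ((hBT e he).2 h'))) h2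
  · have h0 : A ∩ T₁ ∩ S₁ = ∅ := by
      rw [eq_empty_iff_forall_notMem]
      intro e he
      simp only [mem_inter] at he
      exact hA₁ e he.1.1 he.1.2 he.2
    rw [h0, card_empty, card_pos]
    exact ⟨b₂, by simp [hb₂, hbT₂, hb₂S₁]⟩

/-! ### Avoiding obstructions after an exchange -/

/-- Members tight for `X` in an obstruction that arises after an exchange are also tight for the
set that `X` is to become. -/
lemma IsValid.tight_end (h : IsState 𝓗 c n X W A B) (hv : IsValid 𝓗 c X W A B a b)
    (ho : IsObstruction 𝓗 c (insert a (X.erase b)) (insert b (W.erase a)) (A.erase a) (B.erase b)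
      T₁ T₂ S₁ S₂) :
    #((X \ B ∪ A) ∩ T₁) = c T₁ ∧ #((X \ B ∪ A) ∩ T₂) = c T₂ := by
  have key : ∀ H : Finset α, #((X \ B ∪ A) ∩ H) + #(B ∩ H) = #(X ∩ H) + #(A ∩ H) := by
    intro H
    have hd := h.disj_left
    have hsub := h.subset_left
    rw [disjoint_left] at hd
    have e1 : (X \ B ∪ A) ∩ H = (X ∩ H) \ (B ∩ H) ∪ A ∩ H := by grind
    have e2 : Disjoint ((X ∩ H) \ (B ∩ H)) (A ∩ H) := by
      rw [disjoint_left]; grind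
    rw [e1, card_union_of_disjoint e2, card_sdiff_of_subset (inter_subset_inter_right hsub)]
    have := card_le_card (inter_subset_inter_right (u := H) hsub)
    omega
  have haX : a ∉ X := disjoint_left.1 h.disj_left hv.memA
  have hbX : b ∈ X := h.subset_left hv.memB
  have hc := ho.card_T (hv.isState h)
  have t1 := ho.tight₁
  have t2 := ho.tight₂
  have := key T₁
  have := key T₂
  have := card_exchange_inter haX hbX T₁
  have := card_exchange_inter haX hbX T₂
  have := card_erase_inter hv.memA T₁
  have := card_erase_inter hv.memA T₂
  have := card_erase_inter hv.memB T₁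
  have := card_erase_inter hv.memB T₂
  omega

lemma IsState.card_end (h : IsState 𝓗 c n X W A B) : #(X \ B ∪ A) = n := by
  have hd : Disjoint (X \ B) A := by
    have := h.disj_left
    rw [disjoint_left] at this ⊢
    grind
  rw [card_union_of_disjoint hd, card_sdiff_of_subset h.subset_left, h.card_eq, ← h.card_left]
  have := card_le_card h.subset_left
  omega

/-- Replacing the entering element by one that lies in the same tight member. -/
lemma IsValid.replace (hs : Sparse 𝓗 c n) (h : IsState 𝓗 c n X W A B)
    (hv : IsValid 𝓗 c X W A B a b) {T S : Finset α} (hT : T ∈ 𝓗) (hS : S ∈ 𝓗)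
    (tT : #(insert a (X.erase b) ∩ T) = c T) (tS : #(insert b (W.erase a) ∩ S) = c S)
    (haT : a ∈ T) (haS : a ∉ S) {a₀ : α} (ha₀ : a₀ ∈ A.erase a) (ha₀T : a₀ ∈ T)
    (ha₀S : a₀ ∉ S) : IsValid 𝓗 c X W A B a₀ b := by
  have h' := hv.isState h
  have ha₀X := disjoint_left.1 h'.disj_left ha₀
  have ha₀W := h'.subset_right ha₀
  have haX : a ∉ X := disjoint_left.1 h.disj_left hv.memA
  have hbW : b ∉ W := disjoint_left.1 h.disj_right hv.memB
  have haW : a ∈ W := h.subset_right hv.memA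
  have hbX : b ∈ X := h.subset_left hv.memB
  refine ⟨(mem_erase.1 ha₀).2, hv.memB, fun H hH tH ha₀H ↦ ?_, fun H hH tH hbH ↦ ?_⟩
  · by_contra hbH
    have h1 := card_exchange_inter haX hbX H
    have h2 := h'.feasible_left H hH
    rw [if_neg hbH] at h1
    split_ifs at h1 with haH
    · omega
    · rw [h'.eq_of_mem_of_notMem hs ha₀X hT hH tT (by omega) ha₀T ha₀H] at haT
      exact haH haT
  · by_contra ha₀H
    have h1 := card_exchange_inter hbW haW H
    have h2 := h'.feasible_right H hH
    rw [if_pos hbH] at h1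
    split_ifs at h1 with haH
    · rw [h'.symm.eq_of_notMem_of_mem hs ha₀W hS hH tS (by omega) ha₀S ha₀H] at haS
      exact haS haH
    · omega

/-- Two obstructions that arise after exchanges with the same `b` are formed by the same members
of the family. -/
lemma IsObstruction.type_eq (hs : Sparse 𝓗 c n) (h : IsState 𝓗 c n X W A B)
    (hv : IsValid 𝓗 c X W A B a b)
    (ho : IsObstruction 𝓗 c (insert a (X.erase b)) (insert b (W.erase a)) (A.erase a) (B.erase b)
      T₁ T₂ S₁ S₂) {a₀ : α} {T₃ T₄ S₃ S₄ : Finset α} (hv₀ : IsValid 𝓗 c X W A B a₀ b)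
    (ho₀ : IsObstruction 𝓗 c (insert a₀ (X.erase b)) (insert b (W.erase a₀)) (A.erase a₀)
      (B.erase b) T₃ T₄ S₃ S₄) (e : α) :
    ((e ∈ T₃ ↔ e ∉ T₄) → (e ∈ T₁ ↔ e ∉ T₂)) ∧ ((e ∈ S₃ ↔ e ∉ S₄) → (e ∈ S₁ ↔ e ∉ S₂)) := by
  have h' := hv.isState h
  obtain ⟨⟨b₁, hb₁, hb₁T, hb₁S⟩, ⟨b₂, hb₂, hb₂T, hb₂S⟩, -, -⟩ := ho.exists_mem h'
  have hBX : ∀ f ∈ B.erase b, f ∉ X \ B ∪ A := by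
    intro f hf
    have hd := h.disj_right
    have hA := h.subset_right
    rw [disjoint_left] at hd
    grind
  have hBW : ∀ f ∈ B.erase b, f ∈ W \ A ∪ B := by grind
  have cY := h.card_end
  have cV := h.symm.card_end
  obtain ⟨t₁, t₂⟩ := hv.tight_end h ho
  obtain ⟨t₃, t₄⟩ := hv₀.tight_end h ho₀
  obtain ⟨s₁, s₂⟩ := hv.symm.tight_end h.symm (ho.symm h')
  obtain ⟨s₃, s₄⟩ := hv₀.symm.tight_end h.symm (ho₀.symm (hv₀.isState h))
  -- The sets reached at the end do not depend on the exchange chosen, so the members of both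
  -- obstructions are tight for the same sets. Each `f` lies in `T₁` or `T₂`, so a third tight
  -- member through `f` would put `f` into the end of `X`, which it leaves.
  have outT : ∀ T ∈ 𝓗, #((X \ B ∪ A) ∩ T) = c T → T ≠ T₁ → T ≠ T₂ → ∀ f ∈ B.erase b, f ∉ T := by
    intro T hT tT h1 h2 f hf hfT
    have e1 := (tight_pair hs cY hT ho.mem₁ h1 tT t₁).1
    have e2 := (tight_pair hs cY hT ho.mem₂ h2 tT t₂).1
    have e3 := ho.typeB_T f hf
    have e4 := hBX f hf
    by_cases hf1 : f ∈ T₁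
    · exact e4 (e1 (mem_inter.2 ⟨hfT, hf1⟩))
    · exact e4 (e2 (mem_inter.2 ⟨hfT, by tauto⟩))
  -- Dually, `f` lies in the end of `W` and outside one of `S₁`, `S₂`, so every other tight member
  -- has to cover it.
  have inS : ∀ S ∈ 𝓗, #((W \ A ∪ B) ∩ S) = c S → S ≠ S₁ → S ≠ S₂ → ∀ f ∈ B.erase b, f ∈ S := by
    intro S hS tS h1 h2 f hf
    have e1 := (tight_pair hs cV hS ho.mem₃ h1 tS s₁).2 (hBW f hf)
    have e2 := (tight_pair hs cV hS ho.mem₄ h2 tS s₂).2 (hBW f hf)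
    have e3 := ho.typeB_S f hf
    simp only [mem_union] at e1 e2
    tauto
  have hT3 : T₃ = T₁ ∨ T₃ = T₂ := by
    by_contra! hcon
    have o1 := outT T₃ ho₀.mem₁ t₃ hcon.1 hcon.2
    by_cases h4 : T₄ = T₁ ∨ T₄ = T₂
    · rcases h4 with h4 | h4
      · have := ho₀.typeB_T b₂ hb₂
        have := ho.typeB_T b₂ hb₂
        have := o1 b₂ hb₂
        subst h4
        tauto
      · have := ho₀.typeB_T b₁ hb₁
        have := ho.typeB_T b₁ hb₁
        have := o1 b₁ hb₁
        subst h4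
        tauto
    · push Not at h4
      have o2 := outT T₄ ho₀.mem₂ t₄ h4.1 h4.2 b₁ hb₁
      have := ho₀.typeB_T b₁ hb₁
      have := o1 b₁ hb₁
      tauto
  have hT4 : T₄ = T₁ ∨ T₄ = T₂ := by
    by_contra! hcon
    have o1 := outT T₄ ho₀.mem₂ t₄ hcon.1 hcon.2
    have q1 := ho₀.typeB_T b₂ hb₂
    have q2 := ho.typeB_T b₂ hb₂
    have q3 := o1 b₂ hb₂
    have q4 := ho₀.typeB_T b₁ hb₁
    have q5 := ho.typeB_T b₁ hb₁
    have q6 := o1 b₁ hb₁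
    rcases hT3 with h4 | h4 <;> subst h4 <;> tauto
  have hS3 : S₃ = S₁ ∨ S₃ = S₂ := by
    by_contra! hcon
    have o1 := inS S₃ ho₀.mem₃ s₃ hcon.1 hcon.2
    by_cases h4 : S₄ = S₁ ∨ S₄ = S₂
    · have q1 := ho₀.typeB_S b₂ hb₂
      have q3 := o1 b₂ hb₂
      have q4 := ho₀.typeB_S b₁ hb₁
      have q6 := o1 b₁ hb₁
      rcases h4 with h4 | h4 <;> subst h4 <;> tauto
    · push Not at h4
      have o2 := inS S₄ ho₀.mem₄ s₄ h4.1 h4.2 b₁ hb₁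
      have := ho₀.typeB_S b₁ hb₁
      have := o1 b₁ hb₁
      tauto
  have hS4 : S₄ = S₁ ∨ S₄ = S₂ := by
    by_contra! hcon
    have o1 := inS S₄ ho₀.mem₄ s₄ hcon.1 hcon.2
    have q1 := ho₀.typeB_S b₂ hb₂
    have q3 := o1 b₂ hb₂
    have q4 := ho₀.typeB_S b₁ hb₁
    have q6 := o1 b₁ hb₁
    rcases hS3 with h4 | h4 <;> subst h4 <;> tauto
  have hT34 : T₃ ≠ T₄ := by
    rintro rfl
    have := ho₀.typeB_T b₁ hb₁
    tauto
  have hS34 : S₃ ≠ S₄ := by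
    rintro rfl
    have := ho₀.typeB_S b₁ hb₁
    tauto
  constructor
  · rcases hT3 with rfl | rfl <;> rcases hT4 with rfl | rfl
    · exact absurd rfl hT34
    · exact id
    · exact fun h ↦ by rw [h, not_not]
    · exact absurd rfl hT34
  · rcases hS3 with rfl | rfl <;> rcases hS4 with rfl | rfl
    · exact absurd rfl hS34
    · exact id
    · exact fun h ↦ by rw [h, not_not]
    · exact absurd rfl hS34

/-- If an exchange leads to an obstruction in which the entering element has no type, then another
exchange avoids all obstructions. -/
lemma IsObstruction.exists_replace (hs : Sparse 𝓗 c n) (h : IsState 𝓗 c n X W A B)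
    (hv : IsValid 𝓗 c X W A B a b)
    (ho : IsObstruction 𝓗 c (insert a (X.erase b)) (insert b (W.erase a)) (A.erase a) (B.erase b)
      T₁ T₂ S₁ S₂) (ha : ¬ ((a ∈ T₁ ↔ a ∉ T₂) ∧ (a ∈ S₁ ↔ a ∉ S₂))) :
    ∃ a₀, IsValid 𝓗 c X W A B a₀ b ∧ ∀ T₃ T₄ S₃ S₄, ¬ IsObstruction 𝓗 c (insert a₀ (X.erase b))
      (insert b (W.erase a₀)) (A.erase a₀) (B.erase b) T₃ T₄ S₃ S₄ := by
  have h' := hv.isState h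
  obtain ⟨⟨b₁, hb₁, hb₁T, hb₁S⟩, -, ⟨a₁, ha₁, ha₁T, ha₁S⟩, ⟨a₂, ha₂, ha₂T, ha₂S⟩⟩ :=
    ho.exists_mem h'
  have hT12 : T₁ ≠ T₂ := by
    rintro rfl
    have := ho.typeB_T b₁ hb₁
    tauto
  have hS12 : S₁ ≠ S₂ := by
    rintro rfl
    have := ho.typeB_S b₁ hb₁
    tauto
  have haT : a ∈ T₁ ∪ T₂ :=
    (tight_pair hs h'.card_left ho.mem₁ ho.mem₂ hT12 ho.tight₁ ho.tight₂).2 (by simp)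
  have haS : a ∉ S₁ ∩ S₂ := by
    intro hcon
    have := (tight_pair hs h'.card_right ho.mem₃ ho.mem₄ hS12 ho.tight₃ ho.tight₄).1 hcon
    have hbW : b ∉ W := disjoint_left.1 h.disj_right hv.memB
    have haW : a ∈ W := h.subset_right hv.memA
    simp only [mem_insert, mem_erase, ne_eq, not_true_eq_false, false_and, or_false] at this
    subst this
    exact hbW haW
  -- After exchanging `a₀` instead, `a` is still to be exchanged, so an obstruction would give it a
  -- type; `type_eq` carries this type back to the first obstruction.
  have fin : ∀ a₀, a₀ ∈ A.erase a → IsValid 𝓗 c X W A B a₀ b →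
      ∃ a₀, IsValid 𝓗 c X W A B a₀ b ∧ ∀ T₃ T₄ S₃ S₄, ¬ IsObstruction 𝓗 c (insert a₀ (X.erase b))
      (insert b (W.erase a₀)) (A.erase a₀) (B.erase b) T₃ T₄ S₃ S₄ := by
    intro a₀ ha₀ hv₀
    refine ⟨a₀, hv₀, fun T₃ T₄ S₃ S₄ ho₀ ↦ ha ?_⟩
    have hmem : a ∈ A.erase a₀ := mem_erase.2 ⟨(mem_erase.1 ha₀).1.symm, hv.memA⟩
    obtain ⟨q1, q2⟩ := ho.type_eq hs h hv hv₀ ho₀ a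
    exact ⟨q1 (ho₀.typeA_T a hmem), q2 (ho₀.typeA_S a hmem)⟩
  simp only [mem_union, mem_inter] at haT haS
  -- Without a type, `a` lies in both `T₁`, `T₂` or outside both `S₁`, `S₂`. In either case it
  -- agrees with `a₁` on `T₁`, `S₁` or with `a₂` on `T₂`, `S₂`, as `replace` requires.
  by_cases hcase : a ∈ T₁ ∧ a ∉ S₁
  · exact fin a₁ ha₁ (hv.replace hs h ho.mem₁ ho.mem₃ ho.tight₁ ho.tight₃ hcase.1 hcase.2 ha₁ ha₁T
      (by have := ho.typeA_S a₁ ha₁; tauto))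
  · have hcase' : a ∈ T₂ ∧ a ∉ S₂ := by tauto
    exact fin a₂ ha₂ (hv.replace hs h ho.mem₂ ho.mem₄ ho.tight₂ ho.tight₄ hcase'.1 hcase'.2 ha₂
      ha₂T (by have := ho.typeA_S a₂ ha₂; tauto))

lemma iff_and_iff_of_imp {p q p' q' : Prop} (h : p ↔ ¬ q) (h' : p' ↔ ¬ q') (hp : p' → p)
    (hq : q' → q) : (p ↔ p') ∧ (q ↔ q') := by
  tauto

/-- An exchange of two elements of types relative to the resulting obstruction starts from an
obstruction. -/
lemma IsObstruction.of_exchange (h : IsState 𝓗 c n X W A B)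
    (hv : IsValid 𝓗 c X W A B a b)
    (ho : IsObstruction 𝓗 c (insert a (X.erase b)) (insert b (W.erase a)) (A.erase a) (B.erase b)
      T₁ T₂ S₁ S₂) (haT : a ∈ T₁ ↔ a ∉ T₂) (haS : a ∈ S₁ ↔ a ∉ S₂)
    (hbT : b ∈ T₁ ↔ b ∉ T₂) (hbS : b ∈ S₁ ↔ b ∉ S₂) :
    IsObstruction 𝓗 c X W A B T₁ T₂ S₁ S₂ := by
  have haX : a ∉ X := disjoint_left.1 h.disj_left hv.memA
  have hbW : b ∉ W := disjoint_left.1 h.disj_right hv.memB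
  have haW : a ∈ W := h.subset_right hv.memA
  have hbX : b ∈ X := h.subset_left hv.memB
  -- A member that lost `b`, did not gain `a` and is tight now was overfull before.
  have key₁ : ∀ T ∈ 𝓗, #(insert a (X.erase b) ∩ T) = c T → b ∈ T → a ∈ T := by
    intro T hT tT hb
    by_contra hna
    have h1 := card_exchange_inter haX hbX T
    have h2 := h.feasible_left T hT
    rw [if_pos hb, if_neg hna] at h1
    omega
  have key₂ : ∀ S ∈ 𝓗, #(insert b (W.erase a) ∩ S) = c S → a ∈ S → b ∈ S := by
    intro T hT tT hb
    by_contra hna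
    have h1 := card_exchange_inter hbW haW T
    have h2 := h.feasible_right T hT
    rw [if_pos hb, if_neg hna] at h1
    omega
  obtain ⟨eT₁, eT₂⟩ := iff_and_iff_of_imp haT hbT (key₁ T₁ ho.mem₁ ho.tight₁)
    (key₁ T₂ ho.mem₂ ho.tight₂)
  obtain ⟨eS₁, eS₂⟩ := iff_and_iff_of_imp hbS haS (key₂ S₁ ho.mem₃ ho.tight₃)
    (key₂ S₂ ho.mem₄ ho.tight₄)
  rw [iff_comm] at eS₁ eS₂
  have cX : ∀ H, (a ∈ H ↔ b ∈ H) → #(insert a (X.erase b) ∩ H) = #(X ∩ H) := by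
    intro H hH
    have h1 := card_exchange_inter haX hbX H
    simp only [hH] at h1
    omega
  have cW : ∀ H, (a ∈ H ↔ b ∈ H) → #(insert b (W.erase a) ∩ H) = #(W ∩ H) := by
    intro H hH
    have h1 := card_exchange_inter hbW haW H
    simp only [hH] at h1
    omega
  refine ⟨ho.mem₁, ho.mem₂, ho.mem₃, ho.mem₄, ?_, ?_, ?_, ?_, ?_, ?_, ?_, ?_, ?_⟩
  · rw [← cX _ eT₁, ho.tight₁]
  · rw [← cX _ eT₂, ho.tight₂]
  · rw [← cW _ eS₁, ho.tight₃]
  · rw [← cW _ eS₂, ho.tight₄]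
  · intro e he
    by_cases hea : e = a
    · subst hea; exact haT
    · exact ho.typeA_T e (mem_erase.2 ⟨hea, he⟩)
  · intro e he
    by_cases hea : e = b
    · subst hea; exact hbT
    · exact ho.typeB_T e (mem_erase.2 ⟨hea, he⟩)
  · intro e he
    by_cases hea : e = a
    · subst hea; exact haS
    · exact ho.typeA_S e (mem_erase.2 ⟨hea, he⟩)
  · intro e he
    by_cases hea : e = b
    · subst hea; exact hbS
    · exact ho.typeB_S e (mem_erase.2 ⟨hea, he⟩)
  · have h1 := card_erase_inter hv.memA (T₁ ∩ S₁)
    have h2 := card_erase_inter hv.memB (T₁ ∩ S₁)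
    have h3 := ho.lt
    have h4 : a ∈ T₁ ∩ S₁ ↔ b ∈ T₁ ∩ S₁ := by simp only [mem_inter, eT₁, eS₁]
    simp only [inter_assoc, h4] at h1 h2 h3 ⊢
    omega

/-- Take any valid exchange. If it creates an obstruction, then `a` and `b` cannot both have types,
since the obstruction would have been there before; an element without a type can be replaced, which
avoids every obstruction. -/
lemma IsState.exists_valid (hs : Sparse 𝓗 c n) (h : IsState 𝓗 c n X W A B) (hA : A.Nonempty)
    (hno : ∀ T₁ T₂ S₁ S₂, ¬ IsObstruction 𝓗 c X W A B T₁ T₂ S₁ S₂) :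
    ∃ a b, IsValid 𝓗 c X W A B a b ∧ ∀ T₁ T₂ S₁ S₂, ¬ IsObstruction 𝓗 c (insert a (X.erase b))
      (insert b (W.erase a)) (A.erase a) (B.erase b) T₁ T₂ S₁ S₂ := by
  obtain ⟨a, b, hv⟩ : ∃ a b, IsValid 𝓗 c X W A B a b := by
    by_contra! hcon
    obtain ⟨T₁, T₂, S₁, S₂, ho⟩ := h.exists_obstruction hs hA hcon
    exact hno _ _ _ _ ho
  by_cases hob : ∃ T₁ T₂ S₁ S₂, IsObstruction 𝓗 c (insert a (X.erase b))
      (insert b (W.erase a)) (A.erase a) (B.erase b) T₁ T₂ S₁ S₂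
  swap
  · push Not at hob
    exact ⟨a, b, hv, hob⟩
  obtain ⟨T₁, T₂, S₁, S₂, ho⟩ := hob
  by_cases ha : (a ∈ T₁ ↔ a ∉ T₂) ∧ (a ∈ S₁ ↔ a ∉ S₂)
  swap
  · obtain ⟨a₀, h1, h2⟩ := ho.exists_replace hs h hv ha
    exact ⟨a₀, b, h1, h2⟩
  by_cases hb : (b ∈ T₁ ↔ b ∉ T₂) ∧ (b ∈ S₁ ↔ b ∉ S₂)
  · exact absurd (ho.of_exchange h hv ha.1 ha.2 hb.1 hb.2) (hno _ _ _ _)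
  · obtain ⟨b₀, h1, h2⟩ := (ho.symm (hv.isState h)).exists_replace hs h.symm hv.symm
      (by tauto)
    exact ⟨a, b₀, h1.symm, fun T₃ T₄ S₃ S₄ ho' ↦
      h2 _ _ _ _ (ho'.symm (h1.symm.isState h))⟩

/-! ### From single exchanges to orderings -/

lemma IsState.exists_list (hs : Sparse 𝓗 c n) (h : IsState 𝓗 c n X W A B)
    (hno : ∀ T₁ T₂ S₁ S₂, ¬ IsObstruction 𝓗 c X W A B T₁ T₂ S₁ S₂) :
    ∃ l : List (α × α), (l.map Prod.fst).Nodup ∧ (l.map Prod.snd).Nodup ∧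
      (l.map Prod.fst).toFinset = A ∧ (l.map Prod.snd).toFinset = B ∧
      ∀ l₁ l₂, l = l₁ ++ l₂ →
        Feasible 𝓗 c (X \ (l₁.map Prod.snd).toFinset ∪ (l₁.map Prod.fst).toFinset) ∧
        Feasible 𝓗 c (W \ (l₁.map Prod.fst).toFinset ∪ (l₁.map Prod.snd).toFinset) := by
  induction hm : #A generalizing X W A B with
  | zero =>
    have hA : A = ∅ := card_eq_zero.1 hm
    have hB : B = ∅ := card_eq_zero.1 (h.card_eq ▸ hm)
    refine ⟨[], by simp, by simp, by simp [hA], by simp [hB], fun l₁ l₂ hl ↦ ?_⟩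
    obtain ⟨rfl, rfl⟩ := List.append_eq_nil_iff.1 hl.symm
    simpa using ⟨h.feasible_left, h.feasible_right⟩
  | succ m ih =>
    obtain ⟨a, b, hv, hno'⟩ := h.exists_valid hs (card_pos.1 (by omega)) hno
    obtain ⟨l, hl1, hl2, hl3, hl4, hl5⟩ := ih (hv.isState h) hno'
      (by rw [card_erase_of_mem hv.memA]; omega)
    have ha1 : a ∉ (l.map Prod.fst) := by rw [← List.mem_toFinset, hl3]; simp
    have hb1 : b ∉ (l.map Prod.snd) := by rw [← List.mem_toFinset, hl4]; simp
    refine ⟨(a, b) :: l, ?_, ?_, ?_, ?_, ?_⟩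
    · rw [List.map_cons, List.nodup_cons]
      exact ⟨ha1, hl1⟩
    · rw [List.map_cons, List.nodup_cons]
      exact ⟨hb1, hl2⟩
    · rw [List.map_cons, List.toFinset_cons, hl3, insert_erase hv.memA]
    · rw [List.map_cons, List.toFinset_cons, hl4, insert_erase hv.memB]
    · intro l₁ l₂ hl
      rcases l₁ with _ | ⟨p, l₁⟩
      · simpa using ⟨h.feasible_left, h.feasible_right⟩
      · rw [List.cons_append, List.cons.injEq] at hl
        obtain ⟨rfl, hl⟩ := hl
        obtain ⟨q1, q2⟩ := hl5 l₁ l₂ hl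
        have s1 : (l₁.map Prod.fst).toFinset ⊆ A.erase a := by
          rw [← hl3, hl, List.map_append, List.toFinset_append]
          exact subset_union_left
        have s2 : (l₁.map Prod.snd).toFinset ⊆ B.erase b := by
          rw [← hl4, hl, List.map_append, List.toFinset_append]
          exact subset_union_left
        have hdA := h.disj_left
        have hdB := h.disj_right
        have hsA := h.subset_right
        have hsB := h.subset_left
        have hma := hv.memA
        have hmb := hv.memB
        rw [disjoint_left] at hdA hdB
        simp only [List.map_cons, List.toFinset_cons]
        generalize (l₁.map Prod.fst).toFinset = P at q1 q2 s1 ⊢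
        generalize (l₁.map Prod.snd).toFinset = Q at q1 q2 s2 ⊢
        have e1 : X \ insert b Q ∪ insert a P = insert a (X.erase b) \ Q ∪ P := by
          ext e
          simp only [mem_union, mem_sdiff, mem_insert, mem_erase]
          have := @s2 a
          have := @hsB a
          have := @hdA a
          grind
        have e2 : W \ insert a P ∪ insert b Q = insert b (W.erase a) \ P ∪ Q := by
          ext e
          simp only [mem_union, mem_sdiff, mem_insert, mem_erase]
          have := @s1 b
          have := @hsA b
          have := @hdB b
          grind
        rw [e1, e2]
        exact ⟨q1, q2⟩

/-- There is no obstruction between two feasible sets and their complements in the union. -/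
lemma IsState.not_isObstruction (hs : Sparse 𝓗 c n)
    (h : IsState 𝓗 c n B A (A \ B) (B \ A)) (T₁ T₂ S₁ S₂ : Finset α) :
    ¬ IsObstruction 𝓗 c B A (A \ B) (B \ A) T₁ T₂ S₁ S₂ := by
  intro ho
  -- Equal margins make `T₁` tight for `A` as well as for `B`. Then `T₁` and `S₂` are distinct and
  -- tight for `A`, so they cover it, but `a₂` lies in neither.
  obtain ⟨⟨b₁, hb₁, hb₁T, hb₁S⟩, -, -, ⟨a₂, ha₂, ha₂T, ha₂S⟩⟩ := ho.exists_mem h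
  have hne : T₁ ≠ S₂ := by
    rintro rfl
    exact (ho.typeB_S b₁ hb₁).1 hb₁S hb₁T
  have key : ∀ P Q : Finset α, #((P \ Q) ∩ T₁) + #(P ∩ Q ∩ T₁) = #(P ∩ T₁) := by
    intro P Q
    rw [← card_union_of_disjoint]
    · congr 1
      grind
    · rw [disjoint_left]
      grind
  have htight : #(A ∩ T₁) = c T₁ := by
    have h1 := key A B
    have h2 := key B A
    have h3 := (ho.card_T h).1
    have h4 := ho.tight₁
    rw [inter_comm B A] at h2
    omega
  have h5 := (tight_pair hs h.card_right ho.mem₁ ho.mem₄ hne htight ho.tight₄).2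
    (h.subset_right ha₂)
  have h6 := ho.typeA_T a₂ ha₂
  have h7 := ho.typeA_S a₂ ha₂
  grind

lemma feasible_diff_inter {P Q : Finset α} (hP : Feasible 𝓗 c P) (H : Finset α) (hH : H ∈ 𝓗) :
    #(Q ∩ H) + #((P \ Q) ∩ H) ≤ c H + #((Q \ P) ∩ H) := by
  have e1 : #(P ∩ H) = #((P \ Q) ∩ H) + #(P ∩ Q ∩ H) := by
    rw [← card_union_of_disjoint]
    · congr 1
      grind
    · rw [disjoint_left]
      grind
  have e2 : #(Q ∩ H) = #((Q \ P) ∩ H) + #(P ∩ Q ∩ H) := by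
    rw [← card_union_of_disjoint]
    · congr 1
      grind
    · rw [disjoint_left]
      grind
  have := hP H hH
  omega

lemma subset_card_feasible_of_partition {P₁ P₂ Q₁ Q₂ : Finset α} (hB : #B = n)
    (hP : P₁ ∪ P₂ = A \ B) (hQ : Q₁ ∪ Q₂ = B \ A) (hd : Disjoint Q₁ Q₂) (hc : #P₁ = #Q₁)
    (hf : Feasible 𝓗 c (B \ Q₁ ∪ P₁)) :
    A ∩ B ∪ P₁ ∪ Q₂ ⊆ A ∪ B ∧ #(A ∩ B ∪ P₁ ∪ Q₂) = n ∧ Feasible 𝓗 c (A ∩ B ∪ P₁ ∪ Q₂) := by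
  rw [disjoint_left] at hd
  have hP' : ∀ x ∈ P₁, x ∈ A ∧ x ∉ B := fun x hx ↦
    mem_sdiff.1 (hP ▸ mem_union_left _ hx)
  have hQ' : ∀ x, (x ∈ Q₁ ∨ x ∈ Q₂) ↔ x ∈ B ∧ x ∉ A := fun x ↦ by
    rw [← mem_union, hQ, mem_sdiff]
  have e : A ∩ B ∪ P₁ ∪ Q₂ = B \ Q₁ ∪ P₁ := by
    ext x
    have h1 := hP' x
    have h2 := hQ' x
    have h3 := @hd x
    simp only [mem_union, mem_inter, mem_sdiff]
    tauto
  have hQB : Q₁ ⊆ B := fun x hx ↦ ((hQ' x).1 (Or.inl hx)).1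
  rw [e]
  refine ⟨fun x hx ↦ ?_, ?_, hf⟩
  · have h1 := hP' x
    simp only [mem_union, mem_sdiff] at hx ⊢
    tauto
  · rw [card_union_of_disjoint, card_sdiff_of_subset hQB, hc, ← hB]
    · have := card_le_card hQB
      omega
    · rw [disjoint_left]
      intro x hx hx'
      exact (hP' x hx').2 (mem_sdiff.1 hx).1

/-- Any two feasible sets of size `n` in a sparse system have orderings such that exchanging
initial segments gives feasible sets of size `n`. -/
theorem exists_exchange_list (hs : Sparse 𝓗 c n) (hA : #A = n) (hB : #B = n)
    (fA : Feasible 𝓗 c A) (fB : Feasible 𝓗 c B) :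
    ∃ l : List (α × α), (l.map Prod.fst).Nodup ∧ (l.map Prod.snd).Nodup ∧
      (l.map Prod.fst).toFinset = A ∧ (l.map Prod.snd).toFinset = B ∧
      ∀ l₁ l₂, l = l₁ ++ l₂ → ∀ Z : Finset α,
        (Z = (l₁.map Prod.fst).toFinset ∪ (l₂.map Prod.snd).toFinset ∨
          Z = (l₁.map Prod.snd).toFinset ∪ (l₂.map Prod.fst).toFinset) →
        Z ⊆ A ∪ B ∧ #Z = n ∧ Feasible 𝓗 c Z := by
  have hst : IsState 𝓗 c n B A (A \ B) (B \ A) :=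
    ⟨hB, hA, sdiff_subset, sdiff_disjoint, sdiff_subset, sdiff_disjoint,
      card_sdiff_comm (hA.trans hB.symm), fB, fA, feasible_diff_inter fA, feasible_diff_inter fB⟩
  obtain ⟨l, hl1, hl2, hl3, hl4, hl5⟩ := hst.exists_list hs (hst.not_isObstruction hs)
  -- Common elements are paired with themselves and come first, so cutting the list among them gives
  -- back `A` and `B`.
  set l₀ : List (α × α) := (A ∩ B).toList.map fun z ↦ (z, z) with hl₀
  have f1 : l₀.map Prod.fst = (A ∩ B).toList := by simp [hl₀, Function.comp_def]
  have f2 : l₀.map Prod.snd = (A ∩ B).toList := by simp [hl₀, Function.comp_def]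
  have e1 : ((l₀ ++ l).map Prod.fst).toFinset = A := by
    rw [List.map_append, List.toFinset_append, f1, hl3, toList_toFinset, union_comm,
      sdiff_union_inter]
  have e2 : ((l₀ ++ l).map Prod.snd).toFinset = B := by
    rw [List.map_append, List.toFinset_append, f2, hl4, toList_toFinset, inter_comm, union_comm,
      sdiff_union_inter]
  have d1 : ((l₀ ++ l).map Prod.fst).Nodup := by
    rw [List.map_append, f1, List.nodup_append']
    refine ⟨nodup_toList _, hl1, fun x hx hx' ↦ ?_⟩
    rw [← List.mem_toFinset, hl3] at hx'
    simp only [mem_toList, mem_inter, mem_sdiff] at hx hx'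
    exact hx'.2 hx.2
  have d2 : ((l₀ ++ l).map Prod.snd).Nodup := by
    rw [List.map_append, f2, List.nodup_append']
    refine ⟨nodup_toList _, hl2, fun x hx hx' ↦ ?_⟩
    rw [← List.mem_toFinset, hl4] at hx'
    simp only [mem_toList, mem_inter, mem_sdiff] at hx hx'
    exact hx'.2 hx.1
  have hdiag : ∀ l' : List (α × α), l' ⊆ l₀ → l'.map Prod.fst = l'.map Prod.snd := by
    intro l' hl'
    refine List.map_congr_left fun p hp ↦ ?_
    obtain ⟨z, -, rfl⟩ := List.mem_map.1 (hl' hp)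
    rfl
  refine ⟨l₀ ++ l, d1, d2, e1, e2, fun l₁ l₂ hl Z hZ ↦ ?_⟩
  rcases List.append_eq_append_iff.1 hl with ⟨m, rfl, hm⟩ | ⟨m, hm, rfl⟩
  · obtain ⟨q1, q2⟩ := hl5 m l₂ hm
    rw [List.map_append, List.map_append, f1, f2, List.toFinset_append, List.toFinset_append,
      toList_toFinset] at hZ
    rw [hm, List.map_append, List.toFinset_append] at hl3 hl4
    rw [hm, List.map_append] at hl1 hl2
    have dP := List.disjoint_toFinset_iff_disjoint.2 (List.nodup_append'.1 hl1).2.2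
    have dQ := List.disjoint_toFinset_iff_disjoint.2 (List.nodup_append'.1 hl2).2.2
    have cP := List.toFinset_card_of_nodup (List.nodup_append'.1 hl1).1
    have cQ := List.toFinset_card_of_nodup (List.nodup_append'.1 hl2).1
    rw [List.length_map] at cP cQ
    generalize (m.map Prod.fst).toFinset = P₁ at *
    generalize (m.map Prod.snd).toFinset = Q₁ at *
    generalize (l₂.map Prod.fst).toFinset = P₂ at *
    generalize (l₂.map Prod.snd).toFinset = Q₂ at *
    rcases hZ with rfl | rfl
    · exact subset_card_feasible_of_partition hB hl3 hl4 dQ (cP.trans cQ.symm) q1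
    · rw [inter_comm, union_comm A]
      exact subset_card_feasible_of_partition hA hl4 hl3 dP (cQ.trans cP.symm) q2
  · have hm1 : l₁ ⊆ l₀ := by rw [hm]; exact List.subset_append_left _ _
    have hm2 : m ⊆ l₀ := by rw [hm]; exact List.subset_append_right _ _
    have r1 := hdiag l₁ hm1
    have r2 := hdiag m hm2
    rw [hm] at e1 e2
    simp only [List.map_append, List.toFinset_append, r1, r2] at e1 e2 hZ
    rcases hZ with rfl | rfl
    · rw [← union_assoc, e2]
      exact ⟨subset_union_right, hB, fB⟩
    · rw [← union_assoc, e1]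
      exact ⟨subset_union_left, hA, fA⟩

end SparseExchange

namespace Matroid

open Finset

variable {α : Type*} {M : Matroid α}

/-! ### The rank function on finsets -/

/-- The rank of a finset, as a natural number. -/
noncomputable def fRk (M : Matroid α) (S : Finset α) : ℕ := (M.eRk S).toNat

lemma cast_fRk (M : Matroid α) (S : Finset α) : (M.fRk S : ℕ∞) = M.eRk S := by
  refine ENat.natCast_toNat (ne_top_of_le_ne_top ?_ (M.eRk_le_encard S))
  simp

@[simp] lemma fRk_empty : M.fRk ∅ = 0 := by simp [fRk]

lemma fRk_le_card (S : Finset α) : M.fRk S ≤ #S := by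
  have h := M.eRk_le_encard S
  rw [← cast_fRk, Set.encard_coe_eq_coe_finsetCard] at h
  exact_mod_cast h

lemma fRk_mono {S T : Finset α} (h : S ⊆ T) : M.fRk S ≤ M.fRk T := by
  have h := M.eRk_mono (coe_subset.2 h)
  rw [← cast_fRk, ← cast_fRk] at h
  exact_mod_cast h

lemma fRk_submod [DecidableEq α] (S T : Finset α) :
    M.fRk (S ∩ T) + M.fRk (S ∪ T) ≤ M.fRk S + M.fRk T := by
  have h := M.eRk_inter_add_eRk_union_le S T
  rw [← coe_inter, ← coe_union, ← cast_fRk, ← cast_fRk, ← cast_fRk, ← cast_fRk] at h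
  exact_mod_cast h

lemma fRk_union_le [DecidableEq α] (S T : Finset α) :
    M.fRk (S ∪ T) ≤ M.fRk S + M.fRk T := by
  have := M.fRk_submod S T
  omega

lemma indep_iff_fRk {S : Finset α} : M.Indep S ↔ M.fRk S = #S := by
  rw [M.indep_iff_eRk_eq_encard_of_finite S.finite_toSet, ← cast_fRk,
    Set.encard_coe_eq_coe_finsetCard]
  exact_mod_cast Iff.rfl

lemma card_le_fRk {I S : Finset α} (hI : M.Indep I) (h : I ⊆ S) : #I ≤ M.fRk S := by
  rw [← indep_iff_fRk.1 hI]
  exact fRk_mono h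

lemma IsBase.card_inter_le [DecidableEq α] {B : Finset α} (hB : M.IsBase B) (S : Finset α) :
    #(B ∩ S) ≤ M.fRk S :=
  card_le_fRk (hB.indep.subset (by simp)) inter_subset_right

section Ground

variable {E : Finset α} (hE : (E : Set α) = M.E)
include hE

lemma isBase_iff_card {B : Finset α} : M.IsBase B ↔ M.Indep B ∧ #B = M.fRk E := by
  have hr : M.eRank = (M.fRk E : ℕ∞) := by rw [cast_fRk, hE, eRk_ground]
  constructor
  · intro hB
    refine ⟨hB.indep, ?_⟩
    have := hB.encard_eq_eRank
    rw [hr, Set.encard_coe_eq_coe_finsetCard] at this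
    exact_mod_cast this
  · rintro ⟨hI, hc⟩
    refine hI.isBase_of_eRk_ge B.finite_toSet ?_
    rw [hr, ← cast_fRk, indep_iff_fRk.1 hI, hc]

lemma IsBase.card_eq {B : Finset α} (hB : M.IsBase B) : #B = M.fRk E :=
  ((isBase_iff_card hE).1 hB).2

lemma IsBase.subset_finset {B : Finset α} (hB : M.IsBase B) : B ⊆ E := by
  rw [← coe_subset, hE]
  exact hB.subset_ground

lemma exists_finset_eq {B : Set α} (hB : M.IsBase B) : ∃ B' : Finset α, (B' : Set α) = B := by
  have hfin : B.Finite := E.finite_toSet.subset (hE ▸ hB.subset_ground)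
  exact ⟨hfin.toFinset, hfin.coe_toFinset⟩

/-- Any independent subset of `T` extends to an independent subset of `T` of full rank. -/
lemma exists_indep_superset {I T : Finset α} (hI : M.Indep I) (hIT : I ⊆ T) (hT : T ⊆ E) :
    ∃ J : Finset α, I ⊆ J ∧ J ⊆ T ∧ M.Indep J ∧ #J = M.fRk T := by
  obtain ⟨J, hJ, hIJ⟩ := hI.subset_isBasis_of_subset (coe_subset.2 hIT)
    (by rw [← hE]; exact coe_subset.2 hT)
  have hfin : J.Finite := T.finite_toSet.subset hJ.subset
  refine ⟨hfin.toFinset, ?_, ?_, ?_, ?_⟩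
  · rw [← coe_subset]; simpa using hIJ
  · rw [← coe_subset]; simpa using hJ.subset
  · simpa using hJ.indep
  · have := hJ.encard_eq_eRk
    rw [← cast_fRk, ← hfin.coe_toFinset, Set.encard_coe_eq_coe_finsetCard] at this
    exact_mod_cast this

/-- A maximal independent subset of `S` is extended inside `T` and then inside `E`. -/
lemma exists_isBase_chain [DecidableEq α] {S T : Finset α} (hST : S ⊆ T) (hT : T ⊆ E) :
    ∃ B : Finset α, M.IsBase B ∧ #(B ∩ S) = M.fRk S ∧ #(B ∩ T) = M.fRk T := by
  obtain ⟨I, -, hIS, hI, cI⟩ := exists_indep_superset hE (M := M) (I := ∅) (by simp)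
    (empty_subset S) (hST.trans hT)
  obtain ⟨J, hIJ, hJT, hJ, cJ⟩ := exists_indep_superset hE hI (hIS.trans hST) hT
  obtain ⟨B, hJB, hBE, hB, cB⟩ := exists_indep_superset hE hJ (hJT.trans hT) (Subset.refl E)
  have hBase := (isBase_iff_card hE).2 ⟨hB, cB⟩
  refine ⟨B, hBase, le_antisymm (hBase.card_inter_le S) ?_, le_antisymm (hBase.card_inter_le T) ?_⟩
  · rw [← cI]
    exact card_le_card (subset_inter (hIJ.trans hJB) hIS)
  · rw [← cJ]
    exact card_le_card (subset_inter hJB hJT)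

end Ground

/-! ### Exchange lists -/

/-- An exchange list between `A` and `B` inside `S`: orderings of `A ∩ S` and `B ∩ S` such that
in every base the part in `S` can be replaced by any set obtained by exchanging initial
segments. -/
def HasExchangeList [DecidableEq α] (M : Matroid α) (A B S : Finset α) : Prop :=
  ∃ l : List (α × α), (l.map Prod.fst).Nodup ∧ (l.map Prod.snd).Nodup ∧
    (l.map Prod.fst).toFinset = A ∩ S ∧ (l.map Prod.snd).toFinset = B ∩ S ∧
    ∀ l₁ l₂, l = l₁ ++ l₂ → ∀ Y Z : Finset α, M.IsBase Z →
      (Y = (l₁.map Prod.fst).toFinset ∪ (l₂.map Prod.snd).toFinset ∨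
        Y = (l₁.map Prod.snd).toFinset ∪ (l₂.map Prod.fst).toFinset) →
      M.IsBase ((Z \ S ∪ Y : Finset α) : Set α)

lemma hasExchangeList_empty [DecidableEq α] (M : Matroid α) (A B : Finset α) :
    M.HasExchangeList A B ∅ := by
  refine ⟨[], by simp, by simp, by simp, by simp, fun l₁ l₂ hl Y Z hZ hY ↦ ?_⟩
  obtain ⟨rfl, rfl⟩ := List.append_eq_nil_iff.1 hl.symm
  obtain rfl : Y = ∅ := by simpa using hY
  simpa using hZ

lemma HasExchangeList.union [DecidableEq α] {A B S T : Finset α} (hS : M.HasExchangeList A B S)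
    (hT : M.HasExchangeList A B T) (hd : Disjoint S T) : M.HasExchangeList A B (S ∪ T) := by
  obtain ⟨l, n1, n2, f1, f2, hl⟩ := hS
  obtain ⟨m, n1', n2', f1', f2', hm⟩ := hT
  have hd' := disjoint_left.1 hd
  refine ⟨l ++ m, ?_, ?_, ?_, ?_, ?_⟩
  · rw [List.map_append, List.nodup_append']
    refine ⟨n1, n1', List.disjoint_toFinset_iff_disjoint.1 ?_⟩
    rw [f1, f1']
    exact hd.mono inter_subset_right inter_subset_right
  · rw [List.map_append, List.nodup_append']
    refine ⟨n2, n2', List.disjoint_toFinset_iff_disjoint.1 ?_⟩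
    rw [f2, f2']
    exact hd.mono inter_subset_right inter_subset_right
  · rw [List.map_append, List.toFinset_append, f1, f1', ← inter_union_distrib_left]
  · rw [List.map_append, List.toFinset_append, f2, f2', ← inter_union_distrib_left]
  · intro l₁ l₂ hl₁₂ Y Z hZ hY
    -- replace the part in one of the two sets, and then the part in the other
    have key : ∀ P Q : Finset α, P ⊆ S → Q ⊆ T → Y = P ∪ Q →
        Z \ (S ∪ T) ∪ Y = (Z \ S ∪ P) \ T ∪ Q := by
      rintro P Q hP hQ rfl
      ext e
      have := @hP e
      have := @hQ e
      have := @hd' e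
      simp only [mem_union, mem_sdiff]
      tauto
    have sub : ∀ (l' : List (α × α)) (f : α × α → α) (K U : Finset α),
        (l'.map f).toFinset = K ∩ U → ∀ k, k ⊆ l' → (k.map f).toFinset ⊆ U := by
      intro l' f K U h k hk x hx
      have : x ∈ (l'.map f).toFinset := by
        rw [List.mem_toFinset] at hx ⊢
        exact List.map_subset f hk hx
      rw [h] at this
      exact (mem_inter.1 this).2
    rcases List.append_eq_append_iff.1 hl₁₂ with ⟨k, rfl, rfl⟩ | ⟨k, rfl, rfl⟩
    · simp only [List.map_append, List.toFinset_append, union_assoc] at hY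
      rcases hY with hY | hY
      · rw [key _ _ (sub _ _ _ _ f1 l (fun _ h ↦ h)) (union_subset
          (sub _ _ _ _ f1' k (List.subset_append_left _ _))
          (sub _ _ _ _ f2' l₂ (List.subset_append_right _ _))) hY]
        exact hm k l₂ rfl _ _ (hl l [] (by simp) _ Z hZ (Or.inl (by simp))) (Or.inl rfl)
      · rw [key _ _ (sub _ _ _ _ f2 l (fun _ h ↦ h)) (union_subset
          (sub _ _ _ _ f2' k (List.subset_append_left _ _))
          (sub _ _ _ _ f1' l₂ (List.subset_append_right _ _))) hY]
        exact hm k l₂ rfl _ _ (hl l [] (by simp) _ Z hZ (Or.inr (by simp))) (Or.inr rfl)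
    · simp only [List.map_append, List.toFinset_append, ← union_assoc] at hY
      rcases hY with hY | hY
      · rw [key _ _ (union_subset (sub _ _ _ _ f1 l₁ (List.subset_append_left _ _))
          (sub _ _ _ _ f2 k (List.subset_append_right _ _)))
          (sub _ _ _ _ f2' m (fun _ h ↦ h)) hY]
        exact hm [] m rfl _ _ (hl l₁ k rfl _ Z hZ (Or.inl rfl)) (Or.inl (by simp))
      · rw [key _ _ (union_subset (sub _ _ _ _ f2 l₁ (List.subset_append_left _ _))
          (sub _ _ _ _ f1 k (List.subset_append_right _ _)))
          (sub _ _ _ _ f1' m (fun _ h ↦ h)) hY]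
        exact hm [] m rfl _ _ (hl l₁ k rfl _ Z hZ (Or.inr rfl)) (Or.inr (by simp))

lemma image_getElem_lt {β : Type*} (l : List β) (f : β → α) (i : ℕ) [DecidableEq α] :
    (fun j : Fin l.length ↦ f l[j]) '' {j | j.val < i} = (((l.take i).map f).toFinset : Set α) := by
  ext x
  simp only [Set.mem_image, Set.mem_ofPred_eq, List.coe_toFinset, List.mem_map,
    List.mem_take_iff_getElem]
  constructor
  · rintro ⟨j, hj, rfl⟩
    exact ⟨l[j], ⟨j, by have := j.2; omega, rfl⟩, rfl⟩
  · rintro ⟨y, ⟨j, hj, rfl⟩, rfl⟩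
    exact ⟨⟨j, by omega⟩, by simp only; omega, rfl⟩

lemma image_getElem_ge {β : Type*} (l : List β) (f : β → α) (i : ℕ) [DecidableEq α] :
    (fun j : Fin l.length ↦ f l[j]) '' {j | i ≤ j.val} = (((l.drop i).map f).toFinset : Set α) := by
  ext x
  simp only [Set.mem_image, Set.mem_ofPred_eq, List.coe_toFinset, List.mem_map,
    List.mem_drop_iff_getElem]
  constructor
  · rintro ⟨j, hj, rfl⟩
    exact ⟨l[j], ⟨j - i, by have := j.2; omega, by simp [Nat.add_sub_cancel' hj]⟩, rfl⟩
  · rintro ⟨y, ⟨j, hj, rfl⟩, rfl⟩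
    exact ⟨⟨i + j, by omega⟩, by simp, rfl⟩

lemma sequentialSymmetricExchange_of_hasExchangeList [DecidableEq α] {E : Finset α}
    (hE : (E : Set α) = M.E)
    (h : ∀ A B : Finset α, M.IsBase A → M.IsBase B → M.HasExchangeList A B E) :
    M.SequentialSymmetricExchange := by
  intro A B hA hB
  obtain ⟨A, rfl⟩ := exists_finset_eq hE hA
  obtain ⟨B, rfl⟩ := exists_finset_eq hE hB
  obtain ⟨l, n1, n2, f1, f2, hl⟩ := h A B hA hB
  rw [inter_eq_left.2 (hA.subset_finset hE)] at f1
  rw [inter_eq_left.2 (hB.subset_finset hE)] at f2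
  have inj : ∀ f : α × α → α, (l.map f).Nodup →
      Function.Injective (fun j : Fin l.length ↦ f l[j]) := by
    intro f hf j k hjk
    have := (List.nodup_iff_injective_getElem.1 hf) (a₁ := ⟨j, by simp⟩) (a₂ := ⟨k, by simp⟩)
      (by simpa using hjk)
    simpa [Fin.ext_iff] using this
  have ran : ∀ (f : α × α → α) (K : Finset α), (l.map f).toFinset = K →
      Set.range (fun j : Fin l.length ↦ f l[j]) = K := by
    intro f K hK
    have := image_getElem_ge l f 0
    simpa [hK] using this
  refine ⟨l.length, fun j ↦ (l[j]).1, fun j ↦ (l[j]).2, inj _ n1, ran _ _ f1, inj _ n2, ran _ _ f2,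
    fun i _ ↦ ?_⟩
  rw [image_getElem_lt l Prod.fst, image_getElem_lt l Prod.snd, image_getElem_ge l Prod.fst,
    image_getElem_ge l Prod.snd, ← coe_union, ← coe_union]
  have hZ : A \ E = ∅ := sdiff_eq_empty_iff_subset.2 (hA.subset_finset hE)
  have key := hl _ _ (List.take_append_drop i l).symm
  constructor
  · simpa only [hZ, empty_union] using key _ A hA (Or.inl rfl)
  · simpa only [hZ, empty_union] using key _ A hA (Or.inr rfl)

/-! ### Paving matroids -/

lemma IsPaving.fRk_ge {E : Finset α} (hE : (E : Set α) = M.E) (hM : M.IsPaving) {S : Finset α}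
    (hS : S ⊆ E) {k : ℕ} (hk : k < M.fRk E) (hkS : k ≤ #S) : k ≤ M.fRk S := by
  obtain ⟨I, hIS, rfl⟩ := exists_subset_card_eq hkS
  refine card_le_fRk (hM I ?_ ?_) hIS
  · rw [← hE]
    exact coe_subset.2 (hIS.trans hS)
  · rw [Set.encard_coe_eq_coe_finsetCard, ← eRk_ground, ← hE, ← cast_fRk]
    exact_mod_cast hk

/-- Distinct hyperplanes of a paving matroid of rank `r` share at most `r - 2` elements, and a
dependent `r`-set has rank `r - 1`, so it lies in a hyperplane and exceeds its capacity. -/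
theorem IsPaving.sequentialSymmetricExchange [M.Finite] (hM : M.IsPaving) :
    M.SequentialSymmetricExchange := by
  classical
  obtain ⟨E, hE⟩ : ∃ E : Finset α, (E : Set α) = M.E :=
    ⟨M.ground_finite.toFinset, M.ground_finite.coe_toFinset⟩
  refine sequentialSymmetricExchange_of_hasExchangeList hE fun A B hA hB ↦ ?_
  -- the hyperplanes
  set 𝓗 : Set (Finset α) := {H | H ⊆ E ∧ M.fRk H + 1 = M.fRk E ∧
    ∀ K, K ⊆ E → H ⊆ K → M.fRk K + 1 = M.fRk E → K ⊆ H} with h𝓗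
  have hs : SparseExchange.Sparse 𝓗 M.fRk (M.fRk E) := by
    rintro H ⟨hHE, hH, hHm⟩ K ⟨hKE, hK, hKm⟩ hne
    by_contra! hcon
    have h1 : M.fRk E - 1 ≤ M.fRk (H ∩ K) :=
      hM.fRk_ge hE (inter_subset_left.trans hHE) (by omega) (by omega)
    have h2 := M.fRk_submod H K
    have h3 := M.fRk_mono (subset_union_left (s₁ := H) (s₂ := K))
    have h4 := hHm (H ∪ K) (union_subset hHE hKE) subset_union_left (by omega)
    have h5 := hKm (H ∪ K) (union_subset hHE hKE) subset_union_right (by omega)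
    exact hne (Subset.antisymm (subset_union_left.trans h5) (subset_union_right.trans h4))
  have hf : ∀ B : Finset α, M.IsBase B → SparseExchange.Feasible 𝓗 M.fRk B :=
    fun B hB H _ ↦ hB.card_inter_le H
  obtain ⟨l, n1, n2, f1, f2, hl⟩ := SparseExchange.exists_exchange_list hs (hA.card_eq hE)
    (hB.card_eq hE) (hf A hA) (hf B hB)
  refine ⟨l, n1, n2, ?_, ?_, fun l₁ l₂ hl' Y Z hZ hY ↦ ?_⟩
  · rw [f1, inter_eq_left.2 (hA.subset_finset hE)]
  · rw [f2, inter_eq_left.2 (hB.subset_finset hE)]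
  obtain ⟨q1, q2, q3⟩ := hl l₁ l₂ hl' Y hY
  rw [sdiff_eq_empty_iff_subset.2 (hZ.subset_finset hE), empty_union, isBase_iff_card hE]
  have hYE := q1.trans (union_subset (hA.subset_finset hE) (hB.subset_finset hE))
  refine ⟨?_, q2⟩
  by_contra hY
  have h1 : M.fRk Y < #Y := lt_of_le_of_ne (fRk_le_card Y) fun h ↦ hY (indep_iff_fRk.2 h)
  have h2 := hM.fRk_ge hE hYE (k := M.fRk E - 1) (by omega) (by omega)
  obtain ⟨H, hYH, hH⟩ := ((E.powerset.filter fun K ↦ M.fRk K + 1 = M.fRk E).finite_toSet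
    ).exists_le_maximal (a := Y) (by simp [hYE]; omega)
  obtain ⟨hHE, hHr⟩ : H ⊆ E ∧ M.fRk H + 1 = M.fRk E := by simpa using hH.prop
  have h3 := q3 H ⟨hHE, hHr, fun K hK hHK hKr ↦ hH.le_of_ge (by simp [hK, hKr]) hHK⟩
  rw [inter_eq_left.2 hYH] at h3
  omega

end Matroid

namespace Matroid

open Finset

variable {α : Type*} {M : Matroid α} [DecidableEq α]

/-! ### Connectivity in terms of the rank function -/

/-- The restriction of `M` to `C` is connected. -/
def IsConn (M : Matroid α) (C : Finset α) : Prop :=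
  ∀ U ⊆ C, M.fRk U + M.fRk (C \ U) = M.fRk C → U = ∅ ∨ U = C

/-- `F` is a proper nonempty subset of `C` such that both the restriction of `M` to `F` and
the contraction of `M ↾ C` by `F` are connected. -/
structure IsFlacet (M : Matroid α) (C F : Finset α) : Prop where
  nonempty : F.Nonempty
  subset : F ⊆ C
  ne : F ≠ C
  conn : M.IsConn F
  conn_contract : ∀ U, F ⊆ U → U ⊆ C →
    M.fRk U + M.fRk (F ∪ (C \ U)) = M.fRk C + M.fRk F → U = F ∨ U = C

/-- The flacets whose hyperplane meets the interior of the hypersimplex. -/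
structure IsSplitFlacet (M : Matroid α) (C F : Finset α) : Prop extends M.IsFlacet C F where
  lt_card : M.fRk F < #F
  lt_fRk : M.fRk F < M.fRk C

lemma fRk_le_add_sdiff {U C : Finset α} (h : U ⊆ C) : M.fRk C ≤ M.fRk U + M.fRk (C \ U) := by
  have := M.fRk_union_le U (C \ U)
  rwa [union_sdiff_of_subset h] at this

/-- Rank is additive along a separator. -/
lemma fRk_eq_add_of_sep {E S U : Finset α} (hS : S ⊆ E)
    (hsep : M.fRk S + M.fRk (E \ S) = M.fRk E) (hU : U ⊆ E) :
    M.fRk U = M.fRk (U ∩ S) + M.fRk (U \ S) := by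
  have h1 := M.fRk_submod U S
  have h2 := M.fRk_submod (U ∪ S) (E \ S)
  have e1 : (U ∪ S) ∩ (E \ S) = U \ S := by
    ext e
    have := @hU e
    simp only [mem_union, mem_sdiff, mem_inter]
    tauto
  have e2 : U ∪ S ∪ E \ S = E := by
    ext e
    have := @hU e
    have := @hS e
    simp only [mem_union, mem_sdiff]
    tauto
  rw [e1, e2] at h2
  have h3 := M.fRk_union_le (U ∩ S) (U \ S)
  rw [union_comm, sdiff_union_inter] at h3
  omega

/-- A minimal violator is connected: along a separation both sides of the inequality add up, so one
part would already be a violator. -/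
lemma exists_isConn_subset {S X : Finset α} (h : M.fRk S < #(X ∩ S)) :
    ∃ T ⊆ S, M.IsConn T ∧ M.fRk T < #(X ∩ T) := by
  obtain ⟨T, hTS, hT⟩ := ((S.powerset.filter fun K ↦ M.fRk K < #(X ∩ K)).finite_toSet
    ).exists_le_minimal (a := S) (by simpa using h)
  obtain ⟨-, hTr⟩ : T ⊆ S ∧ M.fRk T < #(X ∩ T) := by simpa using hT.prop
  refine ⟨T, hTS, fun U hU hsum ↦ ?_, hTr⟩
  have hmin : ∀ K ⊆ T, M.fRk K < #(X ∩ K) → K = T := fun K hK hKr ↦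
    Subset.antisymm hK (hT.le_of_le (by simpa using ⟨hK.trans hTS, hKr⟩) hK)
  have hc : #(X ∩ U) + #(X ∩ (T \ U)) = #(X ∩ T) := by
    rw [← card_union_of_disjoint, ← inter_union_distrib_left, union_sdiff_of_subset hU]
    exact disjoint_sdiff.mono inter_subset_right inter_subset_right
  by_cases h1 : M.fRk U < #(X ∩ U)
  · exact Or.inr (hmin U hU h1)
  · left
    have h2 := hmin (T \ U) sdiff_subset (by omega)
    rw [Finset.sdiff_eq_self_iff_disjoint] at h2
    exact disjoint_self.1 (h2.mono_left hU)

/-- A dependent set of full size in a connected matroid violates a flacet inequality. -/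
lemma IsConn.exists_isSplitFlacet {C X : Finset α} (hC : M.IsConn C) (hX : X ⊆ C)
    (hc : #X = M.fRk C) (hdep : ¬ M.Indep X) :
    ∃ F, M.IsSplitFlacet C F ∧ M.fRk F < #(X ∩ F) := by
  classical
  have hX' : M.fRk X < #(X ∩ X) := by
    rw [inter_self]
    exact lt_of_le_of_ne (fRk_le_card X) fun h ↦ hdep (indep_iff_fRk.2 h)
  obtain ⟨T, hTX, hTc, hTr⟩ := exists_isConn_subset hX'
  -- Connectedness of the restriction is part of the choice of `F`; maximality gives connectedness
  -- of the contraction.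
  obtain ⟨F, hTF, hF⟩ := ((C.powerset.filter
    fun K ↦ M.IsConn K ∧ M.fRk K < #(X ∩ K)).finite_toSet
    ).exists_le_maximal (a := T) (by simp [hTX.trans hX, hTc, hTr])
  obtain ⟨hFC, hFc, hFr⟩ : F ⊆ C ∧ M.IsConn F ∧ M.fRk F < #(X ∩ F) := by simpa using hF.prop
  have hmax : ∀ K, F ⊆ K → K ⊆ C → M.IsConn K → M.fRk K < #(X ∩ K) → K = F :=
    fun K hK hKC hKc hKr ↦ Subset.antisymm (hF.le_of_ge (by simp [hKC, hKc, hKr]) hK) hK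
  have hne : F ≠ C := by
    rintro rfl
    rw [inter_eq_left.2 hX] at hFr
    omega
  have hnon : F.Nonempty := by
    rw [nonempty_iff_ne_empty]
    rintro rfl
    simp at hFr
  -- adding one side of a separation of the contraction keeps the restriction connected
  have hconn : ∀ U, F ⊆ U → U ⊆ C → M.fRk U + M.fRk (F ∪ (C \ U)) = M.fRk C + M.fRk F →
      M.IsConn U := by
    intro U hFU hUC hsum
    -- By submodularity, a separator of `U` that misses `F` separates the connected set `C`.
    have key : ∀ W ⊆ U, M.fRk W + M.fRk (U \ W) = M.fRk U → Disjoint F W → W = ∅ := by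
      intro W hW hWsum hdis
      have hWC := hW.trans hUC
      have hdis' := disjoint_left.1 hdis
      have h1 := M.fRk_submod (U \ W) (F ∪ (C \ U))
      have e1 : (U \ W) ∩ (F ∪ (C \ U)) = F := by
        ext e
        have := @hFU e
        have := @hdis' e
        simp only [mem_union, mem_sdiff, mem_inter]
        tauto
      have e2 : U \ W ∪ (F ∪ (C \ U)) = C \ W := by
        ext e
        have := @hFU e
        have := @hdis' e
        have := @hUC e
        have := @hW e
        simp only [mem_union, mem_sdiff]
        tauto
      rw [e1, e2] at h1
      have h2 := M.fRk_le_add_sdiff hWC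
      rcases hC W hWC (by omega) with h | h
      · exact h
      · exfalso
        obtain ⟨e, he⟩ := hnon
        exact hdis' he (h ▸ hFC he)
    intro W hW hWsum
    have hFW := fRk_eq_add_of_sep hW hWsum hFU
    rcases hFc (F ∩ W) inter_subset_left (by rw [sdiff_inter_self_left]; exact hFW.symm) with h | h
    · exact Or.inl (key W hW hWsum (disjoint_iff_inter_eq_empty.2 h))
    · right
      have h3 : U \ W = ∅ := key (U \ W) sdiff_subset
        (by rw [Finset.sdiff_sdiff_eq_self hW]; omega)
        (disjoint_sdiff.mono_left (inter_eq_left.1 h))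
      exact Subset.antisymm hW (sdiff_eq_empty_iff_subset.1 h3)
  have hflac : M.IsFlacet C F := by
    refine ⟨hnon, hFC, hne, hFc, fun U hFU hUC hsum ↦ ?_⟩
    set U' := F ∪ (C \ U) with hU'
    have hFU' : F ⊆ U' := subset_union_left
    have hU'C : U' ⊆ C := union_subset hFC sdiff_subset
    have e : F ∪ (C \ U') = U := by
      ext e
      have := @hFU e
      have := @hUC e
      have := @hFC e
      simp only [hU', mem_union, mem_sdiff]
      tauto
    have hcU := hconn U hFU hUC hsum
    have hcU' := hconn U' hFU' hU'C (by rw [e]; omega)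
    have hc1 := card_union_add_card_inter (X ∩ U) (X ∩ U')
    have e1 : X ∩ U ∪ X ∩ U' = X := by
      ext e
      have := @hX e
      simp only [hU', mem_union, mem_sdiff, mem_inter]
      tauto
    have e2 : X ∩ U ∩ (X ∩ U') = X ∩ F := by
      ext e
      have := @hFU e
      simp only [hU', mem_union, mem_sdiff, mem_inter]
      tauto
    rw [e1, e2] at hc1
    -- The counts in `U` and `U'` sum to `#X + #(X ∩ F) > r(C) + r(F) = r(U) + r(U')`, so `U` or
    -- `U'` is a connected violator containing `F`, hence equal to `F`.
    by_cases h1 : M.fRk U < #(X ∩ U)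
    · exact Or.inl (hmax U hFU hUC hcU h1)
    · right
      have h2 := hmax U' hFU' hU'C hcU' (by omega)
      refine Subset.antisymm hUC fun x hx ↦ ?_
      by_contra hxU
      exact hxU (hFU (h2 ▸ mem_union_right _ (mem_sdiff.2 ⟨hx, hxU⟩)))
  refine ⟨F, ⟨hflac, ?_, ?_⟩, hFr⟩
  · exact hFr.trans_le (card_le_card inter_subset_right)
  · rw [← hc]
    exact hFr.trans_le (card_le_card inter_subset_left)

lemma IsConn.lt_add {C U : Finset α} (hC : M.IsConn C) (hU : U ⊆ C) (hne : U.Nonempty)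
    (hne' : U ≠ C) : M.fRk C < M.fRk U + M.fRk (C \ U) := by
  refine lt_of_le_of_ne (fRk_le_add_sdiff hU) fun h ↦ ?_
  rcases hC U hU h.symm with h | h
  · exact hne.ne_empty h
  · exact hne' h

lemma IsConn.fRk_pos {C U : Finset α} (hC : M.IsConn C) (hU : U ⊆ C) (hne : U.Nonempty)
    (hne' : U ≠ C) : 0 < M.fRk U := by
  have h1 := hC.lt_add hU hne hne'
  have h2 := M.fRk_mono (sdiff_subset (s := C) (t := U))
  omega

/-- If `U` had the rank of `F`, the elements of `U \ F` would be loops of the contraction and so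
separate it. -/
lemma IsFlacet.lt_of_ssubset {C F U : Finset α} (hF : M.IsFlacet C F) (hFU : F ⊆ U) (hUC : U ⊆ C)
    (h1 : U ≠ F) (h2 : U ≠ C) : M.fRk F < M.fRk U := by
  refine lt_of_le_of_ne (fRk_mono hFU) fun h ↦ ?_
  have h3 := M.fRk_submod U (F ∪ (C \ U))
  have e1 : U ∩ (F ∪ (C \ U)) = F := by
    ext e
    have := @hFU e
    simp only [mem_union, mem_sdiff, mem_inter]
    tauto
  have e2 : U ∪ (F ∪ (C \ U)) = C := by
    ext e
    have := @hFU e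
    have := @hUC e
    simp only [mem_union, mem_sdiff]
    tauto
  rw [e1, e2] at h3
  have h4 := M.fRk_mono (show F ∪ (C \ U) ⊆ C from union_subset hF.subset sdiff_subset)
  rcases hF.conn_contract U hFU hUC (by omega) with h | h
  · exact h1 h
  · exact h2 h

end Matroid

namespace Matroid

open Finset

variable {α : Type*} {M : Matroid α}

/-! ### Faces of the base polytope -/

/-- The sum of the coordinates in `F`. -/
noncomputable def coordSum (F : Finset α) : StrongDual ℝ (α → ℝ) :=
  ∑ e ∈ F, ContinuousLinearMap.proj (R := ℝ) (φ := fun _ : α ↦ ℝ) e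

lemma coordSum_apply (F : Finset α) (x : α → ℝ) : coordSum F x = ∑ e ∈ F, x e := by
  simp [coordSum]

/-- The face of the base polytope on which the sum of the coordinates in `F` is maximal. -/
def face (M : Matroid α) (F : Finset α) : Set (α → ℝ) :=
  {x | x ∈ M.basePolytope ∧ coordSum F x = M.fRk F}

@[simp] lemma face_empty : M.face ∅ = M.basePolytope := by
  ext x
  simp [face, coordSum_apply]

lemma face_subset (F : Finset α) : M.face F ⊆ M.basePolytope := fun _ h ↦ h.1

lemma mem_basePolytope {B : Finset α} (hB : M.IsBase B) :
    (B : Set α).indicator (1 : α → ℝ) ∈ M.basePolytope :=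
  subset_convexHull ℝ _ ⟨B, hB, rfl⟩

lemma coordSum_eq_zero_of_mem_vectorSpan {P : Set (α → ℝ)} {S : Finset α} {k : ℝ}
    (h : ∀ x ∈ P, coordSum S x = k) {v : α → ℝ} (hv : v ∈ vectorSpan ℝ P) : coordSum S v = 0 := by
  have hle : vectorSpan ℝ P ≤ LinearMap.ker (coordSum S).toLinearMap := by
    rw [vectorSpan_def, Submodule.span_le]
    rintro _ ⟨x, hx, y, hy, rfl⟩
    simp [h x hx, h y hy]
  simpa using hle hv

variable [DecidableEq α]

lemma coordSum_indicator (F B : Finset α) :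
    coordSum F ((B : Set α).indicator (1 : α → ℝ)) = #(B ∩ F) := by
  rw [coordSum_apply, inter_comm, ← filter_mem_eq_inter, card_filter]
  simp [Set.indicator_apply]

lemma mem_face {B F : Finset α} (hB : M.IsBase B) (h : #(B ∩ F) = M.fRk F) :
    (B : Set α).indicator (1 : α → ℝ) ∈ M.face F :=
  ⟨mem_basePolytope hB, by rw [coordSum_indicator, h]⟩

/-- The relation on elements whose classes are the connected components of the matroid
of the face. -/
def Linked (M : Matroid α) (F : Finset α) (e f : α) : Prop :=
  (Pi.single e 1 - Pi.single f 1 : α → ℝ) ∈ vectorSpan ℝ (M.face F)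

lemma Linked.refl (F : Finset α) (e : α) : M.Linked F e e := by
  simp [Linked]

lemma Linked.symm {F : Finset α} {e f : α} (h : M.Linked F e f) : M.Linked F f e := by
  have := (vectorSpan ℝ (M.face F)).neg_mem h
  rwa [neg_sub] at this

lemma Linked.trans {F : Finset α} {e f g : α} (h : M.Linked F e f) (h' : M.Linked F f g) :
    M.Linked F e g := by
  have := (vectorSpan ℝ (M.face F)).add_mem h h'
  rwa [sub_add_sub_cancel] at this

/-- A set on which the coordinate sum is constant on the face is closed under being linked. -/
lemma Linked.mem_of_mem {F S : Finset α} {k : ℝ} (h : ∀ x ∈ M.face F, coordSum S x = k) {e f : α}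
    (hef : M.Linked F e f) (he : e ∈ S) : f ∈ S := by
  have h1 := coordSum_eq_zero_of_mem_vectorSpan h hef
  by_contra hf
  rw [coordSum_apply] at h1
  simp [sum_sub_distrib, he, hf] at h1

section Ground

variable {E : Finset α} (hE : (E : Set α) = M.E)
include hE

lemma coordSum_eq_of_forall {S : Finset α} {k : ℕ}
    (h : ∀ B : Finset α, M.IsBase B → #(B ∩ S) = k) : ∀ x ∈ M.basePolytope, coordSum S x = k := by
  have : M.basePolytope ⊆ {x | coordSum S x = (k : ℝ)} := by
    refine convexHull_min ?_ (convex_hyperplane (coordSum S).toLinearMap.isLinear _)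
    rintro _ ⟨B, hB, rfl⟩
    obtain ⟨B, rfl⟩ := exists_finset_eq hE hB
    change coordSum S _ = _
    rw [coordSum_indicator, h B hB]
  exact this

lemma coordSum_le (S : Finset α) : ∀ x ∈ M.basePolytope, coordSum S x ≤ M.fRk S := by
  have : M.basePolytope ⊆ {x | coordSum S x ≤ (M.fRk S : ℝ)} := by
    refine convexHull_min ?_ (convex_halfSpace_le (coordSum S).toLinearMap.isLinear _)
    rintro _ ⟨B, hB, rfl⟩
    obtain ⟨B, rfl⟩ := exists_finset_eq hE hB
    change coordSum S _ ≤ _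
    rw [coordSum_indicator]
    exact_mod_cast hB.card_inter_le S
  exact this

lemma isExposed_face {F : Finset α} (hF : F ⊆ E) : IsExposed ℝ M.basePolytope (M.face F) := by
  intro _
  refine ⟨coordSum F, ?_⟩
  obtain ⟨B, hB, hBF, -⟩ := exists_isBase_chain hE (Subset.refl F) hF
  ext x
  constructor
  · rintro ⟨hx, hxF⟩
    refine ⟨hx, fun y hy ↦ ?_⟩
    rw [hxF]
    exact coordSum_le hE F y hy
  · rintro ⟨hx, hxF⟩
    refine ⟨hx, le_antisymm (coordSum_le hE F x hx) ?_⟩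
    have := hxF _ (mem_basePolytope hB)
    rwa [coordSum_indicator, hBF] at this

lemma face_nonempty {F : Finset α} (hF : F ⊆ E) : (M.face F).Nonempty := by
  obtain ⟨B, hB, hBF, -⟩ := exists_isBase_chain hE (Subset.refl F) hF
  exact ⟨_, mem_face hB hBF⟩

/-- `B ∩ S` spans `S`, so `B` spans `B ∪ S`, which contains a base. -/
lemma isBase_of_subset_union {Z B S : Finset α} (hZ : M.IsBase Z) (hsub : Z ⊆ B ∪ S)
    (hr : M.fRk S ≤ M.fRk (B ∩ S)) (hcard : #B = M.fRk E) : M.IsBase B := by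
  rw [isBase_iff_card hE]
  refine ⟨indep_iff_fRk.2 (le_antisymm (fRk_le_card B) ?_), hcard⟩
  have h1 := M.fRk_submod B S
  have h2 := M.fRk_mono hsub
  have h3 := indep_iff_fRk.1 hZ.indep
  have h4 := hZ.card_eq hE
  omega

/-- Exchange within the bases of the face. For `e ∈ F`, augment `(B ∩ F) - e` from `B' ∩ F`; the
span of `F` is kept. For `e ∉ F`, an ordinary base exchange cannot lower the count in `F`, and the
rank prevents it from rising. -/
lemma exists_exchange_face {F B B' : Finset α} (hB : M.IsBase B) (hBF : #(B ∩ F) = M.fRk F)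
    (hB' : M.IsBase B') (hBF' : #(B' ∩ F) = M.fRk F) {e : α} (he : e ∈ B) (he' : e ∉ B') :
    ∃ f ∈ B', f ∉ B ∧ M.IsBase (insert f (B.erase e) : Finset α) ∧
      #(insert f (B.erase e) ∩ F) = M.fRk F := by
  by_cases heF : e ∈ F
  · have hI : M.Indep ((B ∩ F).erase e : Finset α) :=
      hB.indep.subset (coe_subset.2 ((erase_subset _ _).trans inter_subset_left))
    have hJ : M.Indep (B' ∩ F : Finset α) := hB'.indep.subset (coe_subset.2 inter_subset_left)
    have hc : #((B ∩ F).erase e) + 1 = #(B ∩ F) := card_erase_add_one (mem_inter.2 ⟨he, heF⟩)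
    obtain ⟨f, hf, hins⟩ := hI.exists_insert_of_encard_lt hJ (by
      rw [Set.encard_coe_eq_coe_finsetCard, Set.encard_coe_eq_coe_finsetCard]
      exact_mod_cast (by omega))
    simp only [coe_inter, coe_erase, Set.mem_sdiff, Set.mem_inter_iff, mem_coe,
      Set.mem_singleton_iff, not_and, not_not] at hf
    obtain ⟨⟨hfB', hfF⟩, hf2⟩ := hf
    have hfB : f ∉ B := fun h ↦ he' (hf2 ⟨h, hfF⟩ ▸ hfB')
    have hcard := SparseExchange.card_exchange_inter hfB he F
    rw [if_pos heF, if_pos hfF] at hcard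
    refine ⟨f, hfB', hfB, ?_, by omega⟩
    refine isBase_of_subset_union hE hB (S := F) ?_ ?_ ?_
    · intro x hx
      by_cases hxe : x = e
      · exact mem_union_right _ (hxe ▸ heF)
      · exact mem_union_left _ (mem_insert_of_mem (mem_erase.2 ⟨hxe, hx⟩))
    · have hsub : insert f ((B ∩ F).erase e) ⊆ insert f (B.erase e) ∩ F := by
        intro x hx
        rcases mem_insert.1 hx with rfl | hx
        · simp [hfF]
        · simp only [mem_erase, mem_inter] at hx
          simp [hx]
      have h1 := M.fRk_mono hsub
      rw [← coe_insert] at hins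
      rw [indep_iff_fRk.1 hins, card_insert_of_notMem (by simp [hfB])] at h1
      omega
    · rw [card_insert_of_notMem (by simp [hfB]), card_erase_add_one he, hB.card_eq hE]
  · obtain ⟨f, hf, hbase⟩ := hB.exchange hB' (show e ∈ (B : Set α) \ B' from ⟨he, he'⟩)
    have hfB : f ∉ B := fun h ↦ hf.2 h
    have hbase' : M.IsBase (insert f (B.erase e) : Finset α) := by simpa using hbase
    have hcard := SparseExchange.card_exchange_inter hfB he F
    have hle := hbase'.card_inter_le F
    refine ⟨f, hf.1, hfB, hbase', ?_⟩
    rw [if_neg heF] at hcard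
    split_ifs at hcard <;> omega

omit hE in
lemma linked_of_exchange {F B : Finset α} (hB : M.IsBase B) (hBF : #(B ∩ F) = M.fRk F) {e f : α}
    (he : e ∈ B) (hf : f ∉ B) (hB' : M.IsBase (insert f (B.erase e) : Finset α))
    (hBF' : #(insert f (B.erase e) ∩ F) = M.fRk F) : M.Linked F e f := by
  have h := vsub_mem_vectorSpan ℝ (mem_face hB hBF) (mem_face hB' hBF')
  have hef : e ≠ f := by rintro rfl; exact hf he
  refine Eq.mpr (congrArg (· ∈ vectorSpan ℝ (M.face F)) ?_) h
  ext x
  simp only [Pi.sub_apply, Pi.single_apply, vsub_eq_sub, Set.indicator_apply, mem_coe, mem_insert,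
    mem_erase, Pi.one_apply]
  by_cases h1 : x = e
  · subst h1; simp [he, hef]
  · by_cases h2 : x = f
    · subst h2; simp [hf, h1]
    · simp [h1, h2]

/-- The bases of a face meet a set that is closed under being linked in equally many elements. -/
lemma card_inter_eq_of_closed {F S : Finset α} (hS : ∀ e ∈ S, ∀ f, M.Linked F e f → f ∈ S)
    {B B' : Finset α} (hB : M.IsBase B) (hBF : #(B ∩ F) = M.fRk F)
    (hB' : M.IsBase B') (hBF' : #(B' ∩ F) = M.fRk F) : #(B ∩ S) = #(B' ∩ S) := by
  induction hm : #(B \ B') generalizing B with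
  | zero =>
    have hsub : B ⊆ B' := sdiff_eq_empty_iff_subset.1 (card_eq_zero.1 hm)
    rw [eq_of_subset_of_card_le hsub (by rw [hB.card_eq hE, hB'.card_eq hE])]
  | succ m ih =>
    obtain ⟨e, he⟩ := card_pos.1 (show 0 < #(B \ B') by omega)
    obtain ⟨heB, heB'⟩ := mem_sdiff.1 he
    obtain ⟨f, hfB', hfB, h1, h2⟩ := exists_exchange_face hE hB hBF hB' hBF' heB heB'
    have hl := linked_of_exchange hB hBF heB hfB h1 h2
    have hiff : e ∈ S ↔ f ∈ S := ⟨fun h ↦ hS e h f hl, fun h ↦ hS f h e hl.symm⟩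
    have hcard := SparseExchange.card_exchange_inter hfB heB S
    have hsd : insert f (B.erase e) \ B' = (B \ B').erase e := by
      ext x
      simp only [mem_sdiff, mem_insert, mem_erase]
      constructor
      · rintro ⟨rfl | h, h'⟩
        · exact absurd hfB' h'
        · exact ⟨h.1, h.2, h'⟩
      · rintro ⟨h, h', h''⟩
        exact ⟨Or.inr ⟨h, h'⟩, h''⟩
    rw [← ih h1 h2 (by rw [hsd, card_erase_of_mem he]; omega)]
    simp only [hiff] at hcard
    omega

/-- One base of the face attains the rank of `S`, another that of `F \ S`; both meet `S` equally
often. Thus unions of classes inside `F` separate `M ↾ F`. -/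
lemma fRk_add_of_closed_subset {F S : Finset α} (hF : F ⊆ E) (hSF : S ⊆ F)
    (hS : ∀ e ∈ S, ∀ f, M.Linked F e f → f ∈ S) : M.fRk S + M.fRk (F \ S) = M.fRk F := by
  obtain ⟨B, hB, hBS, hBF⟩ := exists_isBase_chain hE hSF hF
  obtain ⟨B', hB', hBS', hBF'⟩ := exists_isBase_chain hE (sdiff_subset (s := F) (t := S)) hF
  have h1 := card_inter_eq_of_closed hE hS hB hBF hB' hBF'
  have h2 : #(B' ∩ S) + #(B' ∩ (F \ S)) = #(B' ∩ F) := by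
    rw [← card_union_of_disjoint, ← inter_union_distrib_left, union_sdiff_of_subset hSF]
    exact disjoint_sdiff.mono inter_subset_right inter_subset_right
  omega

/-- The analogue for the contraction: one base of the face attains the rank of `F ∪ S`, another that
of `E \ S`, and they agree on the count in `S`. -/
lemma fRk_add_of_closed_disjoint {F S : Finset α} (hF : F ⊆ E) (hSE : S ⊆ E) (hSF : Disjoint F S)
    (hS : ∀ e ∈ S, ∀ f, M.Linked F e f → f ∈ S) :
    M.fRk (F ∪ S) + M.fRk (E \ S) = M.fRk E + M.fRk F := by
  obtain ⟨B, hB, hBF, hBS⟩ := exists_isBase_chain hE (subset_union_left (s₁ := F) (s₂ := S))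
    (union_subset hF hSE)
  obtain ⟨B', hB', hBF', hBS'⟩ := exists_isBase_chain hE (subset_sdiff.2 ⟨hF, hSF⟩)
    (sdiff_subset (s := E) (t := S))
  have h1 := card_inter_eq_of_closed hE hS hB hBF hB' hBF'
  have h2 : #(B' ∩ S) + #(B' ∩ (E \ S)) = #B' := by
    rw [← card_union_of_disjoint, ← inter_union_distrib_left, union_sdiff_of_subset hSE,
      inter_eq_left.2 (hB'.subset_finset hE)]
    exact disjoint_sdiff.mono inter_subset_right inter_subset_right
  have h3 : #(B ∩ F) + #(B ∩ S) = #(B ∩ (F ∪ S)) := by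
    rw [← card_union_of_disjoint, ← inter_union_distrib_left]
    exact hSF.mono inter_subset_right inter_subset_right
  have h4 := hB'.card_eq hE
  omega

lemma coordSum_eq_of_sep {S : Finset α} (hS : S ⊆ E)
    (hsep : M.fRk S + M.fRk (E \ S) = M.fRk E) :
    ∀ x ∈ M.basePolytope, coordSum S x = M.fRk S := by
  refine coordSum_eq_of_forall hE fun B hB ↦ ?_
  have h1 := hB.card_inter_le S
  have h2 := hB.card_inter_le (E \ S)
  have h3 : #(B ∩ S) + #(B ∩ (E \ S)) = #B := by
    rw [← card_union_of_disjoint, ← inter_union_distrib_left, union_sdiff_of_subset hS,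
      inter_eq_left.2 (hB.subset_finset hE)]
    exact disjoint_sdiff.mono inter_subset_right inter_subset_right
  have h4 := hB.card_eq hE
  omega

lemma basePolytope_apply_eq_zero {e : α} (he : e ∉ E) : ∀ x ∈ M.basePolytope, x e = 0 := by
  intro x hx
  have := coordSum_eq_of_forall hE (S := {e}) (k := 0) (fun B hB ↦ by
    rw [card_eq_zero, ← disjoint_iff_inter_eq_empty, disjoint_singleton_right]
    exact fun h ↦ he (hB.subset_finset hE h)) x hx
  simpa [coordSum_apply] using this

lemma Linked.mem_ground {F : Finset α} {e f : α} (h : M.Linked F e f) (he : e ∈ E) : f ∈ E := by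
  refine Linked.mem_of_mem (k := M.fRk E) (fun x hx ↦ ?_) h he
  exact coordSum_eq_of_sep hE (Subset.refl E) (by simp) x (face_subset F hx)

end Ground

end Matroid

/-! ### Link classes, and the facets given by flacets -/

namespace Matroid

open Finset

variable {α : Type*} {M : Matroid α} [DecidableEq α]

open Classical in
/-- The class of `e` in the ground set `E` under the relation `M.Linked F`. -/
noncomputable def linkClass (M : Matroid α) (E F : Finset α) (e : α) : Finset α :=
  {f ∈ E | M.Linked F e f}

variable {E : Finset α}

lemma mem_linkClass {F : Finset α} {e f : α} :
    f ∈ M.linkClass E F e ↔ f ∈ E ∧ M.Linked F e f := by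
  simp [linkClass]

lemma self_mem_linkClass {F : Finset α} {e : α} (he : e ∈ E) : e ∈ M.linkClass E F e :=
  mem_linkClass.2 ⟨he, Linked.refl F e⟩

lemma linkClass_subset (F : Finset α) (e : α) : M.linkClass E F e ⊆ E :=
  fun _ h ↦ (mem_linkClass.1 h).1

lemma linkClass_eq_of_mem {F : Finset α} {e f : α} (h : f ∈ M.linkClass E F e) :
    M.linkClass E F f = M.linkClass E F e := by
  have h' := (mem_linkClass.1 h).2
  ext g
  rw [mem_linkClass, mem_linkClass]
  exact ⟨fun hg ↦ ⟨hg.1, h'.trans hg.2⟩, fun hg ↦ ⟨hg.1, h'.symm.trans hg.2⟩⟩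

lemma disjoint_linkClass {F : Finset α} {e f : α}
    (h : M.linkClass E F e ≠ M.linkClass E F f) :
    Disjoint (M.linkClass E F e) (M.linkClass E F f) := by
  rw [disjoint_left]
  intro g hg hg'
  exact h ((linkClass_eq_of_mem hg).symm.trans (linkClass_eq_of_mem hg'))

omit [DecidableEq α] in
lemma vectorSpan_face_le (F : Finset α) :
    vectorSpan ℝ (M.face F) ≤ vectorSpan ℝ M.basePolytope :=
  vectorSpan_mono ℝ (face_subset F)

section Ground

variable (hE : (E : Set α) = M.E)
include hE

lemma linkClass_closed {F : Finset α} {e : α} :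
    ∀ f ∈ M.linkClass E F e, ∀ g, M.Linked F f g → g ∈ M.linkClass E F e := by
  intro f hf g hfg
  rw [mem_linkClass] at hf ⊢
  exact ⟨hfg.mem_ground hE hf.1, hf.2.trans hfg⟩

lemma fRk_linkClass_add (e : α) :
    M.fRk (M.linkClass E ∅ e) + M.fRk (E \ M.linkClass E ∅ e) = M.fRk E := by
  have := fRk_add_of_closed_disjoint hE (empty_subset E) (linkClass_subset (M := M) ∅ e)
    (disjoint_empty_left _) (linkClass_closed hE)
  simpa using this

/-- A separator of the class also separates `E`, so its coordinate sum is constant on the polytope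
and it is closed under being linked. -/
lemma isConn_linkClass (e : α) : M.IsConn (M.linkClass E ∅ e) := by
  intro U hU hsum
  have hUE := hU.trans (linkClass_subset (M := M) ∅ e)
  rcases U.eq_empty_or_nonempty with h | ⟨f, hf⟩
  · exact Or.inl h
  right
  have h1 := fRk_linkClass_add (M := M) hE e
  have h2 := M.fRk_union_le (M.linkClass E ∅ e \ U) (E \ M.linkClass E ∅ e)
  have e1 : M.linkClass E ∅ e \ U ∪ E \ M.linkClass E ∅ e = E \ U := by
    ext g
    have := @hU g
    have := @linkClass_subset _ M _ E ∅ e g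
    simp only [mem_union, mem_sdiff]
    tauto
  rw [e1] at h2
  have h3 := M.fRk_le_add_sdiff hUE
  have h4 := coordSum_eq_of_sep hE hUE (by omega)
  refine Subset.antisymm hU fun g hg ↦ ?_
  rw [← linkClass_eq_of_mem (hU hf), mem_linkClass] at hg
  exact hg.2.mem_of_mem (fun x hx ↦ h4 x (face_subset _ hx)) hf

omit hE in
/-- The classes of a face refine the connected components. -/
lemma linkClass_subset_linkClass (F : Finset α) (e : α) :
    M.linkClass E F e ⊆ M.linkClass E ∅ e := by
  intro f hf
  rw [mem_linkClass] at hf ⊢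
  refine ⟨hf.1, ?_⟩
  have := vectorSpan_face_le F hf.2
  rwa [Linked, face_empty]

lemma linkClass_flacet_of_mem {F : Finset α} {e₀ : α} (hF : M.IsFlacet (M.linkClass E ∅ e₀) F)
    {e : α} (he : e ∈ F) : M.linkClass E F e = F := by
  have hFE := hF.subset.trans (linkClass_subset (M := M) ∅ e₀)
  have hsub : M.linkClass E F e ⊆ F := fun f hf ↦
    (mem_linkClass.1 hf).2.mem_of_mem (fun x hx ↦ hx.2) he
  rcases hF.conn _ hsub (fRk_add_of_closed_subset hE hFE hsub (linkClass_closed hE)) with h | h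
  · exact absurd (self_mem_linkClass (M := M) (F := F) (hFE he)) (by simp [h])
  · exact h

omit hE in
lemma disjoint_linkClass_flacet {F : Finset α} {e : α} (he : e ∉ F) :
    Disjoint F (M.linkClass E F e) := by
  rw [disjoint_left]
  exact fun f hf hf' ↦ he ((mem_linkClass.1 hf').2.symm.mem_of_mem (fun x hx ↦ hx.2) hf)

/-- For a flacet, the classes of the face are `F`, `C \ F` and the other components: here a smaller
class would separate the contraction of `C` by `F`. -/
lemma linkClass_flacet_of_mem_sdiff {F : Finset α} {e₀ : α}
    (hF : M.IsFlacet (M.linkClass E ∅ e₀) F) {e : α} (he : e ∈ M.linkClass E ∅ e₀ \ F) :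
    M.linkClass E F e = M.linkClass E ∅ e₀ \ F := by
  obtain ⟨heC, heF⟩ := mem_sdiff.1 he
  have hCE := linkClass_subset (M := M) (E := E) ∅ e₀
  have hself := self_mem_linkClass (M := M) (F := F) (hCE heC)
  have hdis := disjoint_linkClass_flacet (M := M) (E := E) heF
  have hcl := fRk_add_of_closed_disjoint hE (hF.subset.trans hCE) (linkClass_subset F e) hdis
    (linkClass_closed hE)
  have hSC : M.linkClass E F e ⊆ M.linkClass E ∅ e₀ := by
    rw [← linkClass_eq_of_mem heC]
    exact linkClass_subset_linkClass F e
  have hsep := fRk_linkClass_add (M := M) hE e₀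
  generalize M.linkClass E ∅ e₀ = C at *
  generalize M.linkClass E F e = S at *
  have hadd := fRk_eq_add_of_sep hCE hsep (U := E \ S) sdiff_subset
  have hdis' := disjoint_left.1 hdis
  have e1 : (E \ S) ∩ C = C \ S := by
    ext g
    have := @hCE g
    simp only [mem_sdiff, mem_inter]
    tauto
  have e2 : (E \ S) \ C = E \ C := by
    ext g
    have := @hSC g
    simp only [mem_sdiff]
    tauto
  have e3 : F ∪ C \ (F ∪ S) = C \ S := by
    ext g
    have := @hdis' g
    have := @hF.subset g
    simp only [mem_sdiff, mem_union]
    tauto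
  rw [e1, e2] at hadd
  rcases hF.conn_contract (F ∪ S) subset_union_left (union_subset hF.subset hSC)
    (by rw [e3]; omega) with h | h
  · exact absurd (h ▸ mem_union_right F hself) heF
  · rw [← h, union_sdiff_cancel_left hdis]

lemma linkClass_flacet_of_notMem {F : Finset α} {e₀ : α}
    (hF : M.IsFlacet (M.linkClass E ∅ e₀) F) {e : α} (heE : e ∈ E)
    (he : e ∉ M.linkClass E ∅ e₀) : M.linkClass E F e = M.linkClass E ∅ e := by
  have heF : e ∉ F := fun h ↦ he (hF.subset h)
  have hself := self_mem_linkClass (M := M) (F := F) heE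
  have hself' := self_mem_linkClass (M := M) (F := ∅) heE
  have hdis := disjoint_linkClass_flacet (M := M) (E := E) heF
  have hFE := hF.subset.trans (linkClass_subset (M := M) (E := E) ∅ e₀)
  have hcl := fRk_add_of_closed_disjoint hE hFE (linkClass_subset F e) hdis (linkClass_closed hE)
  have hSC := linkClass_subset_linkClass (M := M) (E := E) F e
  have hsep := fRk_linkClass_add (M := M) hE e
  have hconn := isConn_linkClass (M := M) hE e
  have hCE := linkClass_subset (M := M) (E := E) ∅ e
  have hFC : Disjoint F (M.linkClass E ∅ e) :=
    (disjoint_linkClass (fun h ↦ he (h ▸ hself'))).symm.mono_left hF.subset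
  generalize M.linkClass E ∅ e = C at *
  generalize M.linkClass E F e = S at *
  have hFC' := disjoint_left.1 hFC
  have hadd := fRk_eq_add_of_sep hCE hsep (U := E \ S) sdiff_subset
  have hadd' := fRk_eq_add_of_sep hCE hsep (U := F ∪ S) (union_subset hFE (hSC.trans hCE))
  have e1 : (E \ S) ∩ C = C \ S := by
    ext g
    have := @hCE g
    simp only [mem_sdiff, mem_inter]
    tauto
  have e2 : (E \ S) \ C = E \ C := by
    ext g
    have := @hSC g
    simp only [mem_sdiff]
    tauto
  have e3 : (F ∪ S) ∩ C = S := by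
    ext g
    have := @hSC g
    have := @hFC' g
    simp only [mem_union, mem_inter]
    tauto
  have e4 : (F ∪ S) \ C = F := by
    ext g
    have := @hSC g
    have := @hFC' g
    simp only [mem_union, mem_sdiff]
    tauto
  rw [e1, e2] at hadd
  rw [e3, e4] at hadd'
  rcases hconn S hSC (by omega) with h | h
  · exact absurd hself (by simp [h])
  · exact h

omit hE in
/-- A vector whose sum over each class vanishes lies in the direction of the face. -/
lemma mem_vectorSpan_face {F : Finset α} {v : α → ℝ} (hv : ∀ e ∉ E, v e = 0)
    (h : ∀ e ∈ E, coordSum (M.linkClass E F e) v = 0) : v ∈ vectorSpan ℝ (M.face F) := by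
  classical
  let s : Setoid α := ⟨M.Linked F, Linked.refl F, Linked.symm, Linked.trans⟩
  let ρ : α → α := fun e ↦ (Quotient.mk s e).out
  have hρ : ∀ e, M.Linked F e (ρ e) := fun e ↦ Linked.symm (Quotient.mk_out (s := s) e)
  have hρ' : ∀ e f, ρ e = ρ f ↔ M.Linked F e f := by
    intro e f
    constructor
    · intro hef
      have h1 := hρ e
      rw [hef] at h1
      exact h1.trans (hρ f).symm
    · intro hef
      exact congrArg Quotient.out (Quotient.sound (s := s) hef)
  have hvsum : v = ∑ e ∈ E, v e • (Pi.single e 1 : α → ℝ) := by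
    ext x
    rw [Finset.sum_apply]
    simp only [Pi.smul_apply, Pi.single_apply, smul_eq_mul, mul_ite, mul_one, mul_zero,
      Finset.sum_ite_eq]
    split_ifs with hx
    · rfl
    · exact hv x hx
  -- Moving all the mass of a class to its representative `ρ e` cancels it, which leaves `v` as a
  -- combination of differences of linked unit vectors.
  have hzero : ∑ e ∈ E, v e • (Pi.single (ρ e) 1 : α → ℝ) = 0 := by
    rw [← Finset.sum_fiberwise_of_maps_to (t := E.image ρ) (fun e he ↦ mem_image_of_mem ρ he)]
    refine Finset.sum_eq_zero fun q hq ↦ ?_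
    obtain ⟨e, he, rfl⟩ := mem_image.1 hq
    have h1 : ∀ f ∈ E.filter (fun f ↦ ρ f = ρ e), v f • (Pi.single (ρ f) 1 : α → ℝ)
        = v f • (Pi.single (ρ e) 1 : α → ℝ) := by
      intro f hf
      rw [(mem_filter.1 hf).2]
    rw [Finset.sum_congr rfl h1, ← Finset.sum_smul]
    have h2 : E.filter (fun f ↦ ρ f = ρ e) = M.linkClass E F e := by
      ext f
      rw [mem_filter, mem_linkClass, hρ']
      exact ⟨fun h ↦ ⟨h.1, h.2.symm⟩, fun h ↦ ⟨h.1, h.2.symm⟩⟩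
    rw [h2, ← coordSum_apply, h e he, zero_smul]
  have hfin : v = ∑ e ∈ E, v e • (Pi.single e 1 - Pi.single (ρ e) 1 : α → ℝ) := by
    simp only [smul_sub, Finset.sum_sub_distrib]
    rw [hzero, sub_zero]
    exact hvsum
  rw [hfin]
  exact Submodule.sum_mem _ fun e _ ↦ Submodule.smul_mem _ _ (hρ e)

lemma coordSum_linkClass_eq_zero {v : α → ℝ} (hv : v ∈ vectorSpan ℝ M.basePolytope) (e : α) :
    coordSum (M.linkClass E ∅ e) v = 0 :=
  coordSum_eq_zero_of_mem_vectorSpan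
    (coordSum_eq_of_sep hE (linkClass_subset ∅ e) (fRk_linkClass_add hE e)) hv

lemma apply_eq_zero_of_mem_vectorSpan {v : α → ℝ} (hv : v ∈ vectorSpan ℝ M.basePolytope) {e : α}
    (he : e ∉ E) : v e = 0 := by
  have := coordSum_eq_zero_of_mem_vectorSpan (S := {e}) (k := 0)
    (fun x hx ↦ by simpa [coordSum_apply] using basePolytope_apply_eq_zero hE he x hx) hv
  simpa [coordSum_apply] using this

/-- The direction of the affine hull of a flacet's face. -/
lemma mem_vectorSpan_flacet {F : Finset α} {e₀ : α} (hF : M.IsFlacet (M.linkClass E ∅ e₀) F)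
    {v : α → ℝ} (hv : ∀ e ∉ E, v e = 0) (h : ∀ e, coordSum (M.linkClass E ∅ e) v = 0)
    (hvF : coordSum F v = 0) : v ∈ vectorSpan ℝ (M.face F) := by
  refine mem_vectorSpan_face hv fun e he ↦ ?_
  by_cases heC : e ∈ M.linkClass E ∅ e₀
  · by_cases heF : e ∈ F
    · rw [linkClass_flacet_of_mem hE hF heF, hvF]
    · rw [linkClass_flacet_of_mem_sdiff hE hF (mem_sdiff.2 ⟨heC, heF⟩), coordSum_apply]
      have h1 := sum_sdiff (f := v) hF.subset
      have h2 := h e₀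
      rw [coordSum_apply] at h2 hvF
      rw [h2, hvF, add_zero] at h1
      exact h1
  · rw [linkClass_flacet_of_notMem hE hF he heC]
    exact h e

omit [DecidableEq α] in
lemma finiteDimensional_vectorSpan : FiniteDimensional ℝ (vectorSpan ℝ M.basePolytope) := by
  have hfin : {x : α → ℝ | ∃ B, M.IsBase B ∧ x = B.indicator 1}.Finite := by
    refine (E.powerset.finite_toSet.image
      fun B : Finset α ↦ (B : Set α).indicator (1 : α → ℝ)).subset ?_
    rintro _ ⟨B, hB, rfl⟩
    obtain ⟨B, rfl⟩ := exists_finset_eq hE hB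
    exact ⟨B, by simpa using hB.subset_finset hE, rfl⟩
  rw [basePolytope, ← direction_affineSpan, affineSpan_convexHull, direction_affineSpan]
  exact finiteDimensional_vectorSpan_of_finite ℝ hfin

/-- The direction of the face is the kernel of `coordSum F` on the direction of the polytope. The
functional is nonzero there: it takes the value one on the difference of unit vectors at `e ∈ F` and
at `f` in the rest of the component. -/
lemma isFacet_face {F : Finset α} {e₀ : α} (hF : M.IsFlacet (M.linkClass E ∅ e₀) F) :
    IsFacet M.basePolytope (M.face F) := by
  have hFE := hF.subset.trans (linkClass_subset (M := M) (E := E) ∅ e₀)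
  refine ⟨isExposed_face hE hFE, face_nonempty hE hFE, ?_⟩
  have := finiteDimensional_vectorSpan (M := M) hE
  set V := vectorSpan ℝ M.basePolytope with hV
  let φ : V →ₗ[ℝ] ℝ := (coordSum F).toLinearMap.comp V.subtype
  have hker : vectorSpan ℝ (M.face F) = (LinearMap.ker φ).map V.subtype := by
    ext v
    rw [Submodule.mem_map]
    constructor
    · intro hv
      refine ⟨⟨v, vectorSpan_face_le F hv⟩, ?_, rfl⟩
      rw [LinearMap.mem_ker]
      exact coordSum_eq_zero_of_mem_vectorSpan (fun x hx ↦ hx.2) hv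
    · rintro ⟨⟨w, hw⟩, hwk, rfl⟩
      rw [LinearMap.mem_ker] at hwk
      exact mem_vectorSpan_flacet hE hF (fun e he ↦ apply_eq_zero_of_mem_vectorSpan hE hw he)
        (coordSum_linkClass_eq_zero hE hw) hwk
  have hsurj : LinearMap.range φ = ⊤ := by
    obtain ⟨e, he⟩ := hF.nonempty
    obtain ⟨f, hf⟩ : (M.linkClass E ∅ e₀ \ F).Nonempty := by
      rw [sdiff_nonempty]
      exact fun h ↦ hF.ne (Subset.antisymm hF.subset h)
    obtain ⟨hfC, hfF⟩ := mem_sdiff.1 hf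
    have hl : M.Linked ∅ e f :=
      (mem_linkClass.1 (hF.subset he)).2.symm.trans (mem_linkClass.1 hfC).2
    rw [Linked, face_empty] at hl
    rw [LinearMap.range_eq_top]
    refine LinearMap.surjective (fun h0 ↦ ?_)
    have h1 : φ ⟨_, hl⟩ = 0 := by rw [h0]; rfl
    have h2 : φ ⟨_, hl⟩ = coordSum F (Pi.single e 1 - Pi.single f 1 : α → ℝ) := rfl
    rw [h2, coordSum_apply] at h1
    simp [sum_sub_distrib, he, hfF] at h1
  have hrn := LinearMap.finrank_range_add_finrank_ker φ
  rw [hsurj, finrank_top, Module.finrank_self] at hrn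
  rw [hker, ← (Submodule.equivMapOfInjective V.subtype V.injective_subtype _).finrank_eq, add_comm,
    hrn]

end Ground

end Matroid

namespace Matroid

open Finset

variable {α : Type*} {M : Matroid α} [DecidableEq α] {E : Finset α}

/-! ### Points in the interior of the hypersimplex section -/

/-- A connected set with at least two elements has no loop or coloop. -/
lemma IsConn.fRk_bounds {C : Finset α} (hC : M.IsConn C) (h2 : 1 < #C) :
    0 < M.fRk C ∧ M.fRk C < #C := by
  obtain ⟨e, he⟩ := card_pos.1 (show 0 < #C by omega)
  have hsub : {e} ⊆ C := singleton_subset_iff.2 he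
  have hne : ({e} : Finset α) ≠ C := by
    rintro rfl
    simp at h2
  have h1 := hC.fRk_pos hsub (singleton_nonempty e) hne
  have h3 := hC.lt_add hsub (singleton_nonempty e) hne
  have h4 := M.fRk_le_card {e}
  have h5 := M.fRk_le_card (C \ {e})
  have h6 := M.fRk_mono hsub
  rw [card_singleton] at h4
  rw [card_sdiff_of_subset hsub, card_singleton] at h5
  omega

section Ground

variable (hE : (E : Set α) = M.E)
include hE

lemma mem_affineSpan_basePolytope {x : α → ℝ} (hx : ∀ e ∉ E, x e = 0)
    (h : ∀ e ∈ E, coordSum (M.linkClass E ∅ e) x = M.fRk (M.linkClass E ∅ e)) :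
    x ∈ affineSpan ℝ M.basePolytope := by
  obtain ⟨p, hp⟩ := face_nonempty (M := M) hE (empty_subset E)
  rw [face_empty] at hp
  rw [← AffineSubspace.vsub_right_mem_direction_iff_mem (mem_affineSpan ℝ hp),
    direction_affineSpan, ← face_empty]
  refine mem_vectorSpan_face (E := E) (fun e he ↦ ?_) fun e he ↦ ?_
  · simp [hx e he, basePolytope_apply_eq_zero hE he p hp]
  · rw [vsub_eq_sub, map_sub, h e he,
      coordSum_eq_of_sep hE (linkClass_subset ∅ e) (fRk_linkClass_add hE e) p hp, sub_self]

lemma mem_affineSpan_face {F : Finset α} {e₀ : α} (hF : M.IsFlacet (M.linkClass E ∅ e₀) F)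
    {x : α → ℝ} (hx : x ∈ affineSpan ℝ M.basePolytope) (hxF : coordSum F x = M.fRk F) :
    x ∈ affineSpan ℝ (M.face F) := by
  obtain ⟨p, hp⟩ := face_nonempty (M := M) hE
    (hF.subset.trans (linkClass_subset (M := M) (E := E) ∅ e₀))
  have hv := AffineSubspace.vsub_mem_direction hx (mem_affineSpan ℝ (face_subset F hp))
  rw [direction_affineSpan] at hv
  rw [← AffineSubspace.vsub_right_mem_direction_iff_mem (mem_affineSpan ℝ hp),
    direction_affineSpan]
  refine mem_vectorSpan_flacet hE hF (fun e he ↦ apply_eq_zero_of_mem_vectorSpan hE hv he)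
    (coordSum_linkClass_eq_zero hE hv) ?_
  rw [vsub_eq_sub, map_sub, hxF, hp.2, sub_self]

lemma coordSum_eq_of_mem_affineSpan {x : α → ℝ} (hx : x ∈ affineSpan ℝ M.basePolytope)
    {S : Finset α} {k : ℝ} (hS : ∀ y ∈ M.basePolytope, coordSum S y = k) : coordSum S x = k := by
  obtain ⟨p, hp⟩ := face_nonempty (M := M) hE (empty_subset E)
  rw [face_empty] at hp
  have hv := AffineSubspace.vsub_mem_direction hx (mem_affineSpan ℝ hp)
  rw [direction_affineSpan] at hv
  have h1 := coordSum_eq_zero_of_mem_vectorSpan hS hv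
  rw [vsub_eq_sub, map_sub, hS p hp, sub_eq_zero] at h1
  exact h1

lemma mem_hypersimplexSection {x : α → ℝ} (hx : x ∈ affineSpan ℝ M.basePolytope)
    (h : ∀ e ∈ E, 0 ≤ x e ∧ x e ≤ 1) : x ∈ M.hypersimplexSection := by
  refine ⟨⟨fun e he ↦ h e (by rwa [← hE] at he), fun e he ↦ ?_, ?_⟩, hx⟩
  · have he' : e ∉ E := by rwa [← hE] at he
    have := coordSum_eq_of_mem_affineSpan hE hx (S := {e}) (k := 0)
      (fun y hy ↦ by simpa [coordSum_apply] using basePolytope_apply_eq_zero hE he' y hy)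
    simpa [coordSum_apply] using this
  · rw [← hE, finsum_mem_coe_finset, ← coordSum_apply,
      coordSum_eq_of_mem_affineSpan hE hx (coordSum_eq_of_sep hE (Subset.refl E) (by simp)),
      fRk, hE, eRk_ground]

omit [DecidableEq α] hE in
lemma affineSpan_hypersimplexSection :
    affineSpan ℝ M.hypersimplexSection ≤ affineSpan ℝ M.basePolytope :=
  affineSpan_le.2 fun _ h ↦ h.2

/-- At a singleton component the coordinate is constant on the affine hull, so only the other
coordinates need to be strictly between the bounds, and that is an open condition. -/
lemma mem_intrinsicInterior {x : α → ℝ} (hx : x ∈ affineSpan ℝ M.basePolytope)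
    (h : ∀ e ∈ E, (0 < x e ∧ x e < 1) ∨ M.linkClass E ∅ e = {e}) :
    x ∈ intrinsicInterior ℝ M.hypersimplexSection := by
  have hfix : ∀ e, M.linkClass E ∅ e = {e} → ∀ y ∈ affineSpan ℝ M.basePolytope,
      0 ≤ y e ∧ y e ≤ 1 := by
    intro e he y hy
    have h1 := coordSum_eq_of_mem_affineSpan hE hy
      (coordSum_eq_of_sep hE (linkClass_subset ∅ e) (fRk_linkClass_add hE e))
    rw [he, coordSum_apply, sum_singleton] at h1
    have h2 := M.fRk_le_card {e}
    rw [card_singleton] at h2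
    rw [h1]
    exact ⟨by positivity, by exact_mod_cast h2⟩
  let U : Set (α → ℝ) := ⋂ e ∈ E.filter (fun e ↦ M.linkClass E ∅ e ≠ {e}),
    (fun y : α → ℝ ↦ y e) ⁻¹' Set.Ioo 0 1
  have hU : IsOpen U := isOpen_biInter_finset fun e _ ↦ isOpen_Ioo.preimage (continuous_apply e)
  have hmem : ∀ y ∈ U, y ∈ affineSpan ℝ M.basePolytope → y ∈ M.hypersimplexSection := by
    intro y hyU hy
    refine mem_hypersimplexSection hE hy fun e he ↦ ?_
    by_cases hc : M.linkClass E ∅ e = {e}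
    · exact hfix e hc y hy
    · have := Set.mem_iInter₂.1 hyU e (mem_filter.2 ⟨he, hc⟩)
      exact ⟨this.1.le, this.2.le⟩
  have hxU : x ∈ U := by
    refine Set.mem_iInter₂.2 fun e he ↦ ?_
    obtain ⟨he, hc⟩ := mem_filter.1 he
    exact (h e he).resolve_right hc
  have hxQ := hmem x hxU hx
  rw [_root_.mem_intrinsicInterior]
  refine ⟨⟨x, subset_affineSpan ℝ _ hxQ⟩, ?_, rfl⟩
  rw [mem_interior]
  refine ⟨Subtype.val ⁻¹' U, fun y hy ↦ ?_, hU.preimage continuous_subtype_val, hxU⟩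
  exact hmem _ hy (affineSpan_hypersimplexSection y.2)

/-- The face determines the classes, so the only alternative to `F = G` is that they are
complementary in the component; then the ranks would add up, against connectedness. -/
lemma face_ne_face {F G : Finset α} {e₀ : α} (hF : M.IsFlacet (M.linkClass E ∅ e₀) F)
    (hG : M.IsFlacet (M.linkClass E ∅ e₀) G) (hne : F ≠ G) : M.face F ≠ M.face G := by
  intro heq
  obtain ⟨e, he⟩ := hF.nonempty
  have hcls : M.linkClass E F e = M.linkClass E G e := by
    ext f
    rw [mem_linkClass, mem_linkClass, Linked, Linked, heq]
  rw [linkClass_flacet_of_mem hE hF he] at hcls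
  by_cases heG : e ∈ G
  · exact hne (hcls.trans (linkClass_flacet_of_mem hE hG heG))
  rw [linkClass_flacet_of_mem_sdiff hE hG (mem_sdiff.2 ⟨hF.subset he, heG⟩)] at hcls
  have hlt := (isConn_linkClass (M := M) hE e₀).lt_add hG.subset hG.nonempty hG.ne
  obtain ⟨x, hx⟩ := face_nonempty (M := M) hE
    (hF.subset.trans (linkClass_subset (M := M) (E := E) ∅ e₀))
  have h1 := hx.2
  have h2 := (heq ▸ hx : x ∈ M.face G).2
  have h3 := coordSum_eq_of_sep hE (linkClass_subset ∅ e₀) (fRk_linkClass_add hE e₀) x hx.1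
  rw [coordSum_apply] at h1 h2 h3
  rw [← sum_sdiff hG.subset, ← hcls, h1, h2] at h3
  rw [← hcls] at hlt
  have : M.fRk F + M.fRk G = M.fRk (M.linkClass E ∅ e₀) := by exact_mod_cast h3
  omega

end Ground

/-! ### Split facets are pairwise far apart -/

/-- Here `a`, `b`, `c`, `d` are the sizes of `F ∩ G`, `F \ G`, `G \ F`, `C \ (F ∪ G)`, and `t` is
the coordinate sum on `F ∩ G`; the equations of `F`, `G`, `C` determine the other three sums. Each
must lie strictly between zero and the size of its part. An empty part forces `t`; otherwise every
lower bound for `t` is below every upper bound. -/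
lemma exists_crossing {a b c d f g r : ℕ} (hf : 0 < f) (hg : 0 < g) (hab : f < a + b)
    (hac : g < a + c) (hfr : f < r) (hgr : g < r) (hcd : r < f + (c + d)) (hbd : r < g + (b + d))
    (hb : 0 < b → f < g + b) (hc : 0 < c → g < f + c) (hd : r < f + g + d)
    (hb0 : b = 0 → 0 < c ∧ 0 < d ∧ f < g) (hc0 : c = 0 → 0 < b ∧ 0 < d ∧ g < f)
    (hlt : f + g < a + r) :
    ∃ t : ℝ, ((a = 0 → t = 0) ∧ (0 < a → 0 < t ∧ t < a)) ∧
      ((b = 0 → f - t = 0) ∧ (0 < b → 0 < f - t ∧ f - t < b)) ∧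
      ((c = 0 → g - t = 0) ∧ (0 < c → 0 < g - t ∧ g - t < c)) ∧
      ((d = 0 → r - f - g + t = 0) ∧ (0 < d → 0 < r - f - g + t ∧ r - f - g + t < d)) := by
  have hab' : (f : ℝ) < a + b := by exact_mod_cast hab
  have hac' : (g : ℝ) < a + c := by exact_mod_cast hac
  have hfr' : (f : ℝ) < r := by exact_mod_cast hfr
  have hgr' : (g : ℝ) < r := by exact_mod_cast hgr
  have hcd' : (r : ℝ) < f + (c + d) := by exact_mod_cast hcd
  have hbd' : (r : ℝ) < g + (b + d) := by exact_mod_cast hbd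
  have hd' : (r : ℝ) < f + g + d := by exact_mod_cast hd
  have hlt' : (f + g : ℝ) < a + r := by exact_mod_cast hlt
  have hf' : (0 : ℝ) < f := by exact_mod_cast hf
  have hg' : (0 : ℝ) < g := by exact_mod_cast hg
  rcases Nat.eq_zero_or_pos a with rfl | ha
  · have hbp : 0 < b := by omega
    have hcp : 0 < c := by omega
    have hdp : 0 < d := by omega
    rw [Nat.cast_zero] at hab' hac' hlt'
    refine ⟨0, ⟨fun _ ↦ rfl, fun h ↦ absurd h (by simp)⟩, ⟨fun h ↦ by omega, fun _ ↦ ?_⟩,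
      ⟨fun h ↦ by omega, fun _ ↦ ?_⟩, ⟨fun h ↦ by omega, fun _ ↦ ?_⟩⟩ <;>
      constructor <;> linarith
  rcases Nat.eq_zero_or_pos b with rfl | hbp
  · obtain ⟨hcp, hdp, hfg⟩ := hb0 rfl
    have hfg' : (f : ℝ) < g := by exact_mod_cast hfg
    have hc' : (g : ℝ) < f + c := by exact_mod_cast hc hcp
    rw [Nat.cast_zero] at hab' hbd'
    refine ⟨f, ⟨fun h ↦ by omega, fun _ ↦ ?_⟩, ⟨fun _ ↦ sub_self _, fun h ↦ absurd h (by simp)⟩,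
      ⟨fun h ↦ by omega, fun _ ↦ ?_⟩, ⟨fun h ↦ by omega, fun _ ↦ ?_⟩⟩ <;>
      constructor <;> linarith
  rcases Nat.eq_zero_or_pos c with rfl | hcp
  · obtain ⟨-, hdp, hfg⟩ := hc0 rfl
    have hfg' : (g : ℝ) < f := by exact_mod_cast hfg
    have hb' : (f : ℝ) < g + b := by exact_mod_cast hb hbp
    rw [Nat.cast_zero] at hac' hcd'
    refine ⟨g, ⟨fun h ↦ by omega, fun _ ↦ ?_⟩, ⟨fun h ↦ by omega, fun _ ↦ ?_⟩,
      ⟨fun _ ↦ sub_self _, fun h ↦ absurd h (by simp)⟩, ⟨fun h ↦ by omega, fun _ ↦ ?_⟩⟩ <;>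
      constructor <;> linarith
  have hb' : (f : ℝ) < g + b := by exact_mod_cast hb hbp
  have hc' : (g : ℝ) < f + c := by exact_mod_cast hc hcp
  rcases Nat.eq_zero_or_pos d with rfl | hdp
  · rw [Nat.cast_zero] at hcd' hbd' hd'
    refine ⟨f + g - r, ⟨fun h ↦ by omega, fun _ ↦ ?_⟩, ⟨fun h ↦ by omega, fun _ ↦ ?_⟩,
      ⟨fun h ↦ by omega, fun _ ↦ ?_⟩, ⟨fun _ ↦ by ring, fun h ↦ absurd h (by simp)⟩⟩ <;>
      constructor <;> linarith
  have hap' : (0 : ℝ) < a := by exact_mod_cast ha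
  have hbp' : (0 : ℝ) < b := by exact_mod_cast hbp
  have hcp' : (0 : ℝ) < c := by exact_mod_cast hcp
  have hdp' : (0 : ℝ) < d := by exact_mod_cast hdp
  have hLU : max (max (0 : ℝ) (f - b)) (max (g - c) (f + g - r))
      < min (min (a : ℝ) f) (min g (d - r + f + g)) := by
    simp only [max_lt_iff, lt_min_iff]
    refine ⟨⟨⟨⟨?_, ?_⟩, ?_, ?_⟩, ⟨?_, ?_⟩, ?_, ?_⟩, ⟨⟨?_, ?_⟩, ?_, ?_⟩, ⟨?_, ?_⟩, ?_, ?_⟩ <;>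
      linarith
  obtain ⟨t, ht1, ht2⟩ := exists_between hLU
  simp only [max_lt_iff, lt_min_iff] at ht1 ht2
  refine ⟨t, ⟨fun h ↦ by omega, fun _ ↦ ?_⟩, ⟨fun h ↦ by omega, fun _ ↦ ?_⟩,
    ⟨fun h ↦ by omega, fun _ ↦ ?_⟩, ⟨fun h ↦ by omega, fun _ ↦ ?_⟩⟩ <;>
    constructor <;> linarith [ht1.1.1, ht1.1.2, ht1.2.1, ht1.2.2,
      ht2.1.1, ht2.1.2, ht2.2.1, ht2.2.2]

omit [DecidableEq α] in
lemma sum_eq_of_forall_eq_div {R : Finset α} {x : α → ℝ} {s : ℝ} (h0 : #R = 0 → s = 0)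
    (h : ∀ e ∈ R, x e = s / #R) : ∑ e ∈ R, x e = s := by
  rw [sum_congr rfl h, sum_const, nsmul_eq_mul]
  by_cases hR : #R = 0
  · simp [hR, h0 hR]
  · have : (#R : ℝ) ≠ 0 := by exact_mod_cast hR
    field_simp

/-- Failure of the inequality is exactly the condition `f + g < a + r` missing from
`exists_crossing`. The resulting point is completed by the average value rank over size on each
other component, and lies on both split hyperplanes in the relative interior. -/
theorem IsSplit.card_inter_add_le (hE : (E : Set α) = M.E) (hM : M.IsSplit) {e₀ : α}
    {F G : Finset α} (hF : M.IsSplitFlacet (M.linkClass E ∅ e₀) F)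
    (hG : M.IsSplitFlacet (M.linkClass E ∅ e₀) G) (hne : F ≠ G) :
    #(F ∩ G) + M.fRk (M.linkClass E ∅ e₀) ≤ M.fRk F + M.fRk G := by
  by_contra! hlt
  set C := M.linkClass E ∅ e₀ with hCdef
  have hC : M.IsConn C := isConn_linkClass hE e₀
  have hCE : C ⊆ E := linkClass_subset ∅ e₀
  have cF : #(F ∩ G) + #(F \ G) = #F := by rw [add_comm, card_sdiff_add_card_inter]
  have cG : #(F ∩ G) + #(G \ F) = #G := by
    rw [inter_comm, add_comm, card_sdiff_add_card_inter]
  have cCF : #(G \ F) + #(C \ (F ∪ G)) = #(C \ F) := by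
    rw [← card_union_of_disjoint]
    · congr 1
      ext e
      have := @hG.subset e
      simp only [mem_union, mem_sdiff]
      tauto
    · rw [disjoint_left]
      intro e
      simp only [mem_union, mem_sdiff]
      tauto
  have cCG : #(F \ G) + #(C \ (F ∪ G)) = #(C \ G) := by
    rw [← card_union_of_disjoint]
    · congr 1
      ext e
      have := @hF.subset e
      simp only [mem_union, mem_sdiff]
      tauto
    · rw [disjoint_left]
      intro e
      simp only [mem_union, mem_sdiff]
      tauto
  -- When `F` meets `G`, connectedness of `F` gives `r(F) < r(F ∩ G) + r(F \ G)`; when it does not,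
  -- `r(F) < #F` suffices.
  have key : ∀ {F G : Finset α}, M.IsSplitFlacet C F →
      #(F \ G) ≠ 0 → M.fRk F < M.fRk G + #(F \ G) := by
    intro F G hF hpos
    have h1 := M.fRk_le_card (F \ G)
    rcases (F ∩ G).eq_empty_or_nonempty with h | h
    · have h2 : F \ G = F := by
        rw [Finset.sdiff_eq_self_iff_disjoint, disjoint_iff_inter_eq_empty, h]
      have := hF.lt_card
      rw [h2]
      omega
    · have h2 := hF.conn.lt_add inter_subset_left h (fun h' ↦ hpos (by
        rw [card_eq_zero, sdiff_eq_empty_iff_subset]; exact inter_eq_left.1 h'))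
      rw [sdiff_inter_self_left] at h2
      have h3 := M.fRk_mono (inter_subset_right (s₁ := F) (s₂ := G))
      omega
  have key0 : ∀ {F G : Finset α}, M.IsSplitFlacet C F → M.IsSplitFlacet C G → F ≠ G →
      #(F \ G) = 0 → 0 < #(G \ F) ∧ 0 < #(C \ (F ∪ G)) ∧ M.fRk F < M.fRk G := by
    intro F G hF hG hne h0
    have hsub := sdiff_eq_empty_iff_subset.1 (card_eq_zero.1 h0)
    refine ⟨?_, ?_, hF.lt_of_ssubset hsub hG.subset hne.symm hG.ne⟩
    · rw [card_pos, sdiff_nonempty]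
      exact fun h ↦ hne (Subset.antisymm hsub h)
    · rw [union_eq_right.2 hsub, card_pos, sdiff_nonempty]
      exact fun h ↦ hG.ne (Subset.antisymm hG.subset h)
  have hCF := hC.lt_add hF.subset hF.nonempty hF.ne
  have hCG := hC.lt_add hG.subset hG.nonempty hG.ne
  -- If `F` and `G` meet, submodularity gains the positive rank of `F ∩ G`; if they are disjoint,
  -- connectedness of `C` gives the strictness.
  have hd : M.fRk C < M.fRk F + M.fRk G + #(C \ (F ∪ G)) := by
    have h1 := M.fRk_le_add_sdiff (union_subset hF.subset hG.subset)
    have h2 := M.fRk_le_card (C \ (F ∪ G))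
    have h3 := M.fRk_submod F G
    rcases (F ∩ G).eq_empty_or_nonempty with h | h
    · have h4 := M.fRk_union_le G (C \ (F ∪ G))
      have e1 : G ∪ C \ (F ∪ G) = C \ F := by
        ext e
        have h5 := @hG.subset e
        have h6 : e ∉ F ∩ G := by simp [h]
        simp only [mem_union, mem_sdiff, mem_inter] at h6 ⊢
        tauto
      rw [e1] at h4
      omega
    · have h4 := hC.fRk_pos (inter_subset_left.trans hF.subset) h (fun h' ↦ hF.ne
        (Subset.antisymm hF.subset (h' ▸ inter_subset_left)))
      omega
  have hCF' := M.fRk_le_card (C \ F)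
  have hCG' := M.fRk_le_card (C \ G)
  obtain ⟨t, ⟨ta0, ta⟩, ⟨tb0, tb⟩, ⟨tc0, tc⟩, ⟨td0, td⟩⟩ :=
    exists_crossing (a := #(F ∩ G)) (b := #(F \ G)) (c := #(G \ F)) (d := #(C \ (F ∪ G)))
    (f := M.fRk F) (g := M.fRk G) (r := M.fRk C)
    (hC.fRk_pos hF.subset hF.nonempty hF.ne) (hC.fRk_pos hG.subset hG.nonempty hG.ne)
    (by rw [cF]; exact hF.lt_card) (by rw [cG]; exact hG.lt_card) hF.lt_fRk hG.lt_fRk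
    (by rw [cCF]; omega) (by rw [cCG]; omega) (fun h ↦ key hF h.ne')
    (fun h ↦ key hG h.ne') hd (key0 hF hG hne)
    (fun h ↦ by have := key0 hG hF hne.symm h; rwa [union_comm G F] at this) hlt
  -- the point with the prescribed sums that is constant on the four parts of `C`
  let x : α → ℝ := fun e ↦
    if e ∈ C then
      if e ∈ F then if e ∈ G then t / #(F ∩ G) else (M.fRk F - t) / #(F \ G)
      else if e ∈ G then (M.fRk G - t) / #(G \ F)
        else (M.fRk C - M.fRk F - M.fRk G + t) / #(C \ (F ∪ G))
    else if e ∈ E then M.fRk (M.linkClass E ∅ e) / #(M.linkClass E ∅ e) else 0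
  have sa : ∑ e ∈ F ∩ G, x e = t := sum_eq_of_forall_eq_div ta0 fun e he ↦ by
    obtain ⟨h1, h2⟩ := mem_inter.1 he
    simp [x, h1, h2, hF.subset h1]
  have sb : ∑ e ∈ F \ G, x e = M.fRk F - t := sum_eq_of_forall_eq_div tb0 fun e he ↦ by
    obtain ⟨h1, h2⟩ := mem_sdiff.1 he
    simp [x, h1, h2, hF.subset h1]
  have sc : ∑ e ∈ G \ F, x e = M.fRk G - t := sum_eq_of_forall_eq_div tc0 fun e he ↦ by
    obtain ⟨h1, h2⟩ := mem_sdiff.1 he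
    simp [x, h1, h2, hG.subset h1]
  have sd : ∑ e ∈ C \ (F ∪ G), x e = M.fRk C - M.fRk F - M.fRk G + t :=
    sum_eq_of_forall_eq_div td0 fun e he ↦ by
      obtain ⟨h1, h2⟩ := mem_sdiff.1 he
      rw [mem_union, not_or] at h2
      simp [x, h1, h2]
  have sF : coordSum F x = M.fRk F := by
    rw [coordSum_apply, ← sum_inter_add_sum_sdiff F G, sa, sb]
    ring
  have sG : coordSum G x = M.fRk G := by
    rw [coordSum_apply, ← sum_inter_add_sum_sdiff G F, inter_comm, sa, sc]
    ring
  have sC : coordSum C x = M.fRk C := by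
    rw [coordSum_apply, ← sum_sdiff (union_subset hF.subset hG.subset), sd,
      ← sum_sdiff (subset_union_right (s₁ := F) (s₂ := G)), union_sdiff_right, sb,
      ← coordSum_apply, sG]
    ring
  have hx : x ∈ affineSpan ℝ M.basePolytope := by
    refine mem_affineSpan_basePolytope hE (fun e he ↦ ?_) fun e he ↦ ?_
    · have heC : e ∉ C := fun h ↦ he (hCE h)
      simp [x, he, heC]
    · by_cases heC : e ∈ C
      · rw [linkClass_eq_of_mem heC]
        exact sC
      · rw [coordSum_apply]
        refine sum_eq_of_forall_eq_div (fun h ↦ ?_) fun f hf ↦ ?_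
        · rw [card_eq_zero.1 h, fRk_empty, Nat.cast_zero]
        · have hfC : f ∉ C := fun h ↦ heC (by
            rw [hCdef, ← linkClass_eq_of_mem h, linkClass_eq_of_mem hf]
            exact self_mem_linkClass he)
          simp [x, hfC, linkClass_subset _ _ hf, linkClass_eq_of_mem hf]
  have unit : ∀ {s : ℝ} {k : ℕ}, 0 < k → 0 < s ∧ s < k → 0 < s / k ∧ s / k < 1 := by
    intro s k hk hs
    have hk' : (0 : ℝ) < k := by exact_mod_cast hk
    exact ⟨div_pos hs.1 hk', (div_lt_one hk').2 hs.2⟩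
  have hint : x ∈ intrinsicInterior ℝ M.hypersimplexSection := by
    refine mem_intrinsicInterior hE hx fun e he ↦ ?_
    by_cases heC : e ∈ C
    · left
      by_cases heF : e ∈ F <;> by_cases heG : e ∈ G
      · have hp : 0 < #(F ∩ G) := card_pos.2 ⟨e, mem_inter.2 ⟨heF, heG⟩⟩
        simpa only [x, heC, heF, heG, if_true] using unit hp (ta hp)
      · have hp : 0 < #(F \ G) := card_pos.2 ⟨e, mem_sdiff.2 ⟨heF, heG⟩⟩
        simpa only [x, heC, heF, heG, if_true, if_false] using unit hp (tb hp)
      · have hp : 0 < #(G \ F) := card_pos.2 ⟨e, mem_sdiff.2 ⟨heG, heF⟩⟩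
        simpa only [x, heC, heF, heG, if_true, if_false] using unit hp (tc hp)
      · have hp : 0 < #(C \ (F ∪ G)) := card_pos.2 ⟨e, by simp [heC, heF, heG]⟩
        simpa only [x, heC, heF, heG, if_true, if_false] using unit hp (td hp)
    · have hself := self_mem_linkClass (M := M) (F := ∅) he
      rcases le_or_gt #(M.linkClass E ∅ e) 1 with h1 | h1
      · right
        exact eq_singleton_iff_unique_mem.2 ⟨hself, fun f hf ↦ card_le_one.1 h1 f hf e hself⟩
      · left
        obtain ⟨h2, h3⟩ := (isConn_linkClass (M := M) hE e).fRk_bounds h1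
        simpa only [x, heC, he, if_true, if_false] using
          unit (by omega) ⟨by exact_mod_cast h2, by exact_mod_cast h3⟩
  have hxF := mem_affineSpan_face hE hF.toIsFlacet hx sF
  have hxG := mem_affineSpan_face hE hG.toIsFlacet hx sG
  exact Set.disjoint_left.1 (hM _ _ ⟨isFacet_face hE hF.toIsFlacet, x, hxF, hint⟩
    ⟨isFacet_face hE hG.toIsFlacet, x, hxG, hint⟩
    (face_ne_face hE hF.toIsFlacet hG.toIsFlacet hne)) ⟨hxF, hxG⟩ hint

/-! ### Exchange in split matroids -/

/-- In a split matroid, the bases restricted to a component are given by a sparse system. -/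
lemma IsSplit.hasExchangeList_linkClass (hE : (E : Set α) = M.E) (hM : M.IsSplit)
    {A B : Finset α} (hA : M.IsBase A) (hB : M.IsBase B) (e₀ : α) :
    M.HasExchangeList A B (M.linkClass E ∅ e₀) := by
  set C := M.linkClass E ∅ e₀ with hCdef
  have hC : M.IsConn C := isConn_linkClass hE e₀
  have hCE : C ⊆ E := linkClass_subset ∅ e₀
  have hcard : ∀ B : Finset α, M.IsBase B → #(B ∩ C) = M.fRk C := by
    intro B hB
    have := coordSum_eq_of_sep hE hCE (fRk_linkClass_add hE e₀) _ (mem_basePolytope hB)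
    rw [coordSum_indicator] at this
    exact_mod_cast this
  have hf : ∀ B : Finset α, M.IsBase B →
      SparseExchange.Feasible {F | M.IsSplitFlacet C F} M.fRk (B ∩ C) := fun B hB F _ ↦
    (card_le_card (inter_subset_inter_right inter_subset_left)).trans (hB.card_inter_le F)
  obtain ⟨l, n1, n2, f1, f2, hl⟩ := SparseExchange.exists_exchange_list
    (𝓗 := {F | M.IsSplitFlacet C F}) (c := M.fRk) (n := M.fRk C)
    (fun F hF G hG hne ↦ hM.card_inter_add_le hE hF hG hne)
    (hcard A hA) (hcard B hB) (hf A hA) (hf B hB)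
  refine ⟨l, n1, n2, f1, f2, fun l₁ l₂ hl' Y Z hZ hY ↦ ?_⟩
  obtain ⟨q1, q2, q3⟩ := hl l₁ l₂ hl' Y hY
  have hYC : Y ⊆ C := q1.trans (union_subset inter_subset_right inter_subset_right)
  have hYi : M.Indep Y := by
    by_contra hdep
    obtain ⟨F, hF, hlt⟩ := hC.exists_isSplitFlacet hYC q2 hdep
    have := q3 F hF
    omega
  -- `Y` is independent of full rank in `C`, so it spans the part of `Z` that it replaces.
  refine isBase_of_subset_union hE hZ (S := C) ?_ ?_ ?_
  · intro e he
    by_cases heC : e ∈ C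
    · exact mem_union_right _ heC
    · exact mem_union_left _ (mem_union_left _ (mem_sdiff.2 ⟨he, heC⟩))
  · rw [← q2, ← indep_iff_fRk.1 hYi]
    exact fRk_mono (subset_inter subset_union_right hYC)
  · rw [card_union_of_disjoint (sdiff_disjoint.mono_right hYC), q2, ← hcard Z hZ,
      card_sdiff_add_card_inter, hZ.card_eq hE]

/-- The classes of the empty face are disjoint and cover `E`, so their exchange lists can be joined
one after another. -/
theorem IsSplit.sequentialSymmetricExchange {M : Matroid α} [M.Finite] (hM : M.IsSplit) :
    M.SequentialSymmetricExchange := by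
  obtain ⟨E, hE⟩ : ∃ E : Finset α, (E : Set α) = M.E :=
    ⟨M.ground_finite.toFinset, M.ground_finite.coe_toFinset⟩
  refine sequentialSymmetricExchange_of_hasExchangeList hE fun A B hA hB ↦ ?_
  have key : ∀ s ⊆ E.image (M.linkClass E ∅), M.HasExchangeList A B (s.biUnion id) := by
    intro s
    induction s using Finset.induction_on with
    | empty => exact fun _ ↦ hasExchangeList_empty M A B
    | insert C s hCs ih =>
      intro hs
      obtain ⟨hC, hs'⟩ := insert_subset_iff.1 hs
      obtain ⟨e, -, rfl⟩ := mem_image.1 hC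
      rw [biUnion_insert]
      refine (hM.hasExchangeList_linkClass hE hA hB e).union (ih hs') ?_
      rw [disjoint_biUnion_right]
      intro D hD
      obtain ⟨f, -, rfl⟩ := mem_image.1 (hs' hD)
      exact disjoint_linkClass fun h ↦ hCs (h ▸ hD)
  have hunion : (E.image (M.linkClass E ∅)).biUnion id = E := by
    ext e
    simp only [mem_biUnion, mem_image, id_eq]
    constructor
    · rintro ⟨_, ⟨f, -, rfl⟩, he⟩
      exact linkClass_subset _ _ he
    · exact fun he ↦ ⟨_, ⟨e, he, rfl⟩, self_mem_linkClass he⟩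
  have := key _ (Subset.refl _)
  rwa [hunion] at this

end Matroid

theorem corollary3p3 {α : Type*} (M : Matroid α) [M.Finite] :
    (M.IsSplit → M.SequentialSymmetricExchange) ∧
      (M.IsPaving → M.SequentialSymmetricExchange) := by
  classical
  exact ⟨fun h ↦ h.sequentialSymmetricExchange, fun h ↦ h.sequentialSymmetricExchange⟩
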